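/- Let $H$ be a real separable Hilbert space, identified with its dual, and $V$ a real reflexive Banach space that is continuously, densely and compactly embedded into $H$, so that $V\subseteq H\subseteq V^*$ with ${}_{V^*}\langle u,v\rangle_V=\langle u,v\rangle_H$ for $u\in H$, $v\in V$. Let $A:V\to V^*$ be Borel measurable and suppose that there are $\alpha\ge 2$, $\varpi\ge 0$, $C,K\ge 0$, $\gamma>0$ and measurable, locally bounded functions $\eta,\rho:V\to[0,\infty)$ such that for all $v,v_1,v_2\in V$: (A1) $s\mapsto{}_{V^*}\langle A(v_1+sv_2),v\rangle_V$ is continuous on $\mathbb R$; (A2) $2\,{}_{V^*}\langle A(v_1)-A(v_2),v_1-v_2\rangle_V\le (C+\eta(v_1)+\rho(v_2))\|v_1-v_2\|_H^2$; (A3) $2\,{}_{V^*}\langle A(v),v\rangle_V\le-\gamma\|v\|_V^\alpha+K\|v\|_H^2+C$; (A4) $\|A(v)\|_{V^*}^{\alpha/(\alpha-1)}\le C(1+\|v\|_V^\alpha)(1+\|v\|_H^\varpi)$. Let $\beta\in\mathbb R$, $T>0$, $\gamma_1>1/2$, and let $\omega:\mathbb R\to\mathbb R$ be any path with $\omega_0=0$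 that is $\gamma_1$-Hölder continuous on every interval $[-k,k]$, $k\in\mathbb N$ (for instance a path of the $\gamma_1$-Hölder version of a fractional Brownian motion with Hurst index larger than $\gamma_1$). Put $z_t=e^{-\beta\omega_t}$, $z_t^{-1}=e^{\beta\omega_t}$. A function $\tilde u\in C([0,T];H)\cap L^\alpha([0,T];V)$ is a (variational) solution of the random PDE $d\tilde u=z_tA(z_t^{-1}\tilde u)\,dt$ with initial value $u_0\in H$ if $\tilde u(0)=u_0$ and $\langle\tilde u(t),v\rangle_H=\langle u_0,v\rangle_H+\int_0^t z_r\,{}_{V^*}\langle A(z_r^{-1}\tilde u(r)),v\rangle_V\,dr$ for all $v\in V$, $t\in[0,T]$. A function $u\in C([0,T];H)\cap L^\alpha([0,T];V)$ is a (variational) solution of the SPDE $du=A(u)\,dt+\beta u\,d\omega$ with initial value $u_0$ if $u(0)=u_0$ and $\langle u(t),v\rangle_H=\langle u_0,v\rangle_H+\int_0^t{}_{V^*}\langle A(u(r)),v\rangle_V\,dr+\int_0^t\beta\langle u(r),v\rangle_H\,d\omega_r$ for all $v\in V$, $t\in[0,T]$, where the last integral is the Young integral, i.e. the limit of the sums $\sum_{[r,s]\in\Pi}\beta\langle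 u(r),v\rangle_H(\omega_s-\omega_r)$ as the mesh of the partition $\Pi$ of $[0,t]$ tends to $0$, and the existence of this limit is part of the definition. **Theorem.** There is a constant $M=M(T,\omega,\beta)>0$, which depends on nothing else (not on $H,V,A$ or the solutions), such that the following holds, where $C$ is the constant of (A2). (i) Let $\tilde u_1,\tilde u_2$ be solutions of the random PDE with initial values $u_0^1,u_0^2\in H$ such that $\int_0^T\big(\rho(z_s^{-1}\tilde u_1(s))+\eta(z_s^{-1}\tilde u_2(s))\big)\,ds<\infty$. Then for all $t\in[0,T]$ $$\|\tilde u_1(t)-\tilde u_2(t)\|_H^2\le\exp\Big[\int_0^t\big(C+\rho(z_s^{-1}\tilde u_1(s))+\eta(z_s^{-1}\tilde u_2(s))\big)ds\Big]\,\|u_0^1-u_0^2\|_H^2 .$$ Moreover $u_i(t)=z_t^{-1}\tilde u_i(t)$, $i=1,2$, are solutions of the SPDE with initial values $u_0^i$; for every $v\in V$ and every $\gamma_2\in[0,\gamma_1\wedge\frac1\alpha]$ the function $\langle u_i,v\rangle_H$ is $\gamma_2$-Hölder continuous on $[0,T]$; and for all $t\in[0,T]$ $$\|u_1(t)-u_2(t)\|_H^2\le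 M\exp\Big[\int_0^t\big(C+\rho(u_1(s))+\eta(u_2(s))\big)ds\Big]\,\|u_0^1-u_0^2\|_H^2 .\qquad(*)$$ (ii) If $u_1,u_2$ are any solutions of the SPDE with initial values $u_0^1,u_0^2\in H$ and $\int_0^T(\rho(u_1(s))+\eta(u_2(s)))\,ds<\infty$, then $(*)$ holds for all $t\in[0,T]$. -/

import Mathlib

open MeasureTheory Set Filter Topology
open scoped NNReal ENNReal

/-- The paths of the driving noise: real functions on the line that vanish at `0` and are
`γ₁`-Hölder continuous on every interval `[-k, k]`. For `1/2 < γ₁ < h` a fractional Brownian motion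
with Hurst index `h` has a version all of whose paths are of this kind. -/
def noisePaths (γ₁ : ℝ≥0) : Set (ℝ → ℝ) :=
  {ω | ω 0 = 0 ∧ ∀ k : ℕ, ∃ K : ℝ≥0, HolderOnWith K γ₁ ω (Icc (-(k : ℝ)) k)}

/-- `I` is the Young integral `∫ₐᵇ y dx` (`a ≤ b`): the limit of the left-point sums
`∑ y (p i) (x (p (i+1)) - x (p i))` over the finite partitions `a = p 0 ≤ ⋯ ≤ p n = b`,
as the mesh tends to `0`. -/
def HasYoungIntegral (y x : ℝ → ℝ) (a b I : ℝ) : Prop :=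
  ∀ ε > 0, ∃ δ > 0, ∀ (n : ℕ) (p : ℕ → ℝ), p 0 = a → p n = b →
    (∀ i < n, p i ≤ p (i + 1) ∧ p (i + 1) - p i < δ) →
    |∑ i ∈ Finset.range n, y (p i) * (x (p (i + 1)) - x (p i)) - I| < ε

section Triple

variable {H : Type*} [NormedAddCommGroup H] [InnerProductSpace ℝ H]
variable {V : Type*} [NormedAddCommGroup V] [NormedSpace ℝ V]

/-- `V ⊆ H ⊆ V*` is a Gelfand triple through the embedding `ι : V → H`: the space `V` is reflexive
and `ι` is injective (and continuous) with dense range. The element `h` of `H` is seen in `V*`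
as `v ↦ ⟪h, ι v⟫`. -/
structure IsGelfandTriple (ι : V →L[ℝ] H) : Prop where
  reflexive : Function.Surjective (NormedSpace.inclusionInDoubleDual ℝ V)
  injective : Function.Injective ι
  denseRange : DenseRange ι

/-- The conditions (A1)-(A4) on a Borel operator `A : V → V*`, with the constants
`α ≥ 2`, `ϖ ≥ 0`, `C, K ≥ 0`, `γ > 0` and the functions `η, ρ : V → [0, ∞)`. -/
structure LocallyMonotoneCoercive [MeasurableSpace V] (ι : V →L[ℝ] H) (A : V → StrongDual ℝ V)
    (α ϖ C K γ : ℝ) (η ρ : V → ℝ) : Prop where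
  measurable : Measurable A
  two_le_alpha : 2 ≤ α
  varpi_nonneg : 0 ≤ ϖ
  C_nonneg : 0 ≤ C
  K_nonneg : 0 ≤ K
  gamma_pos : 0 < γ
  eta_nonneg : ∀ v, 0 ≤ η v
  rho_nonneg : ∀ v, 0 ≤ ρ v
  eta_measurable : Measurable η
  rho_measurable : Measurable ρ
  eta_locallyBounded : ∀ v, ∃ M : ℝ, ∀ᶠ w in 𝓝 v, η w ≤ M
  rho_locallyBounded : ∀ v, ∃ M : ℝ, ∀ᶠ w in 𝓝 v, ρ w ≤ M
  hemicontinuous : ∀ v₁ v₂ v : V, Continuous fun s : ℝ => A (v₁ + s • v₂) v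
  locallyMonotone : ∀ v₁ v₂ : V,
    2 * (A v₁ - A v₂) (v₁ - v₂) ≤ (C + η v₁ + ρ v₂) * ‖ι (v₁ - v₂)‖ ^ 2
  coercive : ∀ v : V, 2 * A v v ≤ -γ * ‖v‖ ^ α + K * ‖ι v‖ ^ 2 + C
  growth : ∀ v : V, ‖A v‖ ^ (α / (α - 1)) ≤ C * (1 + ‖v‖ ^ α) * (1 + ‖ι v‖ ^ ϖ)

/-- `u ∈ C([0,T]; H) ∩ L^α([0,T]; V)`, where `U` is the `V`-valued representative of `u`
(unique up to a null set, as `ι` is injective). -/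
structure IsPath (ι : V →L[ℝ] H) (α T : ℝ) (u : ℝ → H) (U : ℝ → V) : Prop where
  continuousOn : ContinuousOn u (Icc 0 T)
  version : ∀ᵐ r ∂(volume.restrict (Icc 0 T)), ι (U r) = u r
  memLp : MemLp U (ENNReal.ofReal α) (volume.restrict (Icc 0 T))

/-- `u` (with representative `U`) is the variational solution on `[0,T]` of the random equation
`du = z A(z⁻¹ u) dt`, `z_t = exp (-β ω_t)`, with initial value `u₀`, along the path `ω`. -/
structure IsRandomPDESolution (ι : V →L[ℝ] H) (A : V → StrongDual ℝ V) (α β T : ℝ) (ω : ℝ → ℝ)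
    (u₀ : H) (u : ℝ → H) (U : ℝ → V) : Prop where
  isPath : IsPath ι α T u U
  initial : u 0 = u₀
  integrable : ∀ v : V, IntervalIntegrable
    (fun r => Real.exp (-β * ω r) * A (Real.exp (β * ω r) • U r) v) volume 0 T
  equation : ∀ v : V, ∀ t ∈ Icc 0 T, inner ℝ (u t) (ι v) = inner ℝ u₀ (ι v) +
    ∫ r in (0 : ℝ)..t, Real.exp (-β * ω r) * A (Real.exp (β * ω r) • U r) v

/-- `u` (with representative `U`) is the variational solution on `[0,T]` of the equation
`du = A(u) dt + β u dω` with initial value `u₀`, along the path `ω`; the noise integral is a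
Young integral. -/
structure IsSPDESolution (ι : V →L[ℝ] H) (A : V → StrongDual ℝ V) (α β T : ℝ) (ω : ℝ → ℝ)
    (u₀ : H) (u : ℝ → H) (U : ℝ → V) : Prop where
  isPath : IsPath ι α T u U
  initial : u 0 = u₀
  integrable : ∀ v : V, IntervalIntegrable (fun r => A (U r) v) volume 0 T
  equation : ∀ v : V, ∀ t ∈ Icc 0 T, ∃ I : ℝ,
    HasYoungIntegral (fun r => β * inner ℝ (u r) (ι v)) ω 0 t I ∧
    inner ℝ (u t) (ι v) = inner ℝ u₀ (ι v) + (∫ r in (0 : ℝ)..t, A (U r) v) + I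

end Triple

/-!
Put `z = exp (-β ω)`. The proof has three ingredients.

**Transformation.** Multiplication by `z` turns solutions of `du = A(u) dt + β u dω` into solutions
of `dũ = z A(z⁻¹ ũ) dt`, and back. Tested with `v`, this concerns real functions `X` and `y = z X`.
Over an interval `[s, t]`, the error `X t - X s - ∫ a - β X s (ω t - ω s)` of the first equation,
multiplied by `z t`, equals the error `y t - y s - ∫ z a` of the second one up to a term of second
order in `ω t - ω s` and the oscillation of `z` against `∫ |a|`. As `ω` is Hölder continuous with
exponent above `1/2`, its quadratic variation vanishes, so these discrepancies sum to something
small over fine partitions (`exists_sum_abs_exp_mul_increment_sub_le`). If `y` solves the second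
equation, this says that the left-point sums of `β X dω` converge. Conversely, if the Young
integrals exist, then the errors of the first equation are small in absolute sum by a Saks–Henstock
argument (`HasYoungIntegral.saks_henstock`), which needs no Hölder regularity of `X`, and the
increments of `y` telescope.

**Energy equality.** For the difference `w` of two solutions of the random equation, with
derivative `f ∈ L^{α'}(V*)`, one has `‖w t‖² = ‖w 0‖² + 2 ∫₀ᵗ f(W)` (`norm_sq_eq_add_integral`).
Since `‖w(s+h)‖² - ‖w(s)‖² = ∫ₛ^{s+h} f(r)(W(s+h) + W(s)) dr`, averaging over `s` and Fubini's
theorem express the left side through pairings of translates of `f` and `W`, which converge because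
translations are continuous on `L^{α'}` and `L^α`. That `f` lies in `L^{α'}(V*)` rests on the growth
condition on `A` and on the separability of `V*`, which gives strong measurability.

**Grönwall.** Local monotonicity at the points `z⁻¹ u₂`, `z⁻¹ u₁` bounds `2 f(W)` by
`(C + ρ(z⁻¹ u₁) + η(z⁻¹ u₂)) ‖w‖²`, and Grönwall's inequality with an integrable kernel
(`gronwall_of_integrable`) gives the estimate for the random equation. Going back multiplies it by
at most `M`, the square of an upper bound for `z⁻¹` on `[0, T]`.
-/

/-! ### Grönwall's inequality with an integrable kernel -/

/-- The exponential of an absolutely continuous function is absolutely continuous, since `exp` is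
Lipschitz on bounded sets. -/
lemma AbsolutelyContinuousOnInterval.real_exp {f : ℝ → ℝ} {a b : ℝ}
    (hf : AbsolutelyContinuousOnInterval f a b) :
    AbsolutelyContinuousOnInterval (fun t => Real.exp (f t)) a b := by
  obtain ⟨B, hB⟩ := hf.exists_bound
  have hB' : ∀ x ∈ uIcc a b, f x ∈ Icc (-B) B := fun x hx => abs_le.mp (hB x hx)
  obtain ⟨K, hK⟩ := (Real.contDiff_exp.contDiffOn (n := 1) (s := Icc (-B) B)).exists_lipschitzOnWith
    (by decide) (convex_Icc _ _) isCompact_Icc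
  rw [absolutelyContinuousOnInterval_iff] at hf ⊢
  intro ε hε
  obtain ⟨δ, hδ, h⟩ := hf (ε / (K + 1)) (by positivity)
  refine ⟨δ, hδ, fun E hE hlt => ?_⟩
  have h1 := h E hE hlt
  have hmem : ∀ i ∈ Finset.range E.1, (E.2 i).1 ∈ uIcc a b ∧ (E.2 i).2 ∈ uIcc a b := by
    intro i hi
    simpa using hE.1 i hi
  calc ∑ i ∈ Finset.range E.1, dist (Real.exp (f (E.2 i).1)) (Real.exp (f (E.2 i).2))
      ≤ ∑ i ∈ Finset.range E.1, K * dist (f (E.2 i).1) (f (E.2 i).2) :=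
        Finset.sum_le_sum fun i hi =>
          hK.dist_le_mul _ (hB' _ (hmem i hi).1) _ (hB' _ (hmem i hi).2)
    _ = K * ∑ i ∈ Finset.range E.1, dist (f (E.2 i).1) (f (E.2 i).2) := by rw [Finset.mul_sum]
    _ ≤ K * (ε / (K + 1)) := by gcongr
    _ < ε := by
        have hK0 : (0 : ℝ) ≤ K := K.2
        rw [← mul_div_assoc, div_lt_iff₀ (by positivity)]
        nlinarith

/-- Grönwall's inequality for an absolutely continuous function `E` with derivative `e ≤ g E`,
where `g` is merely integrable: `exp (-∫ g) E` is absolutely continuous with nonpositive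
derivative. -/
lemma gronwall_of_integrable {E e g : ℝ → ℝ} {T : ℝ} (hT : 0 ≤ T)
    (he : IntervalIntegrable e volume 0 T) (hg : IntervalIntegrable g volume 0 T)
    (hE : ∀ t ∈ Icc 0 T, E t = E 0 + ∫ s in (0 : ℝ)..t, e s)
    (hle : ∀ᵐ s ∂(volume.restrict (Icc 0 T)), e s ≤ g s * E s) :
    E T ≤ Real.exp (∫ s in (0 : ℝ)..T, g s) * E 0 := by
  have h0 : (0 : ℝ) ∈ uIcc 0 T := left_mem_uIcc
  have hu : uIcc 0 T = Icc 0 T := uIcc_of_le hT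
  set G : ℝ → ℝ := fun t => ∫ s in (0 : ℝ)..t, g s with hG
  set F : ℝ → ℝ := fun t => E 0 + ∫ s in (0 : ℝ)..t, e s with hF
  have hGac : AbsolutelyContinuousOnInterval (fun t => Real.exp ((-1) * G t)) 0 T :=
    ((hg.absolutelyContinuousOnInterval_intervalIntegral h0).const_mul (-1)).real_exp
  have hFac : AbsolutelyContinuousOnInterval F 0 T :=
    (LipschitzOnWith.absolutelyContinuousOnInterval
      (LipschitzWith.const (E 0)).lipschitzOnWith).fun_add
      (he.absolutelyContinuousOnInterval_intervalIntegral h0)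
  have key := hGac.integral_deriv_mul_eq_sub hFac
  have hneg : ∫ x in (0 : ℝ)..T, deriv (fun t => Real.exp ((-1) * G t)) x * F x +
      Real.exp ((-1) * G x) * deriv F x ≤ 0 := by
    rw [intervalIntegral.integral_of_le hT]
    refine integral_nonpos_of_ae ?_
    have hle' := (ae_restrict_iff' measurableSet_Icc).1 hle
    refine (ae_restrict_iff' measurableSet_Ioc).2 ?_
    filter_upwards [hle', hg.ae_hasDerivAt_integral, he.ae_hasDerivAt_integral] with x h1 h2 h3 hx
    have hx' : x ∈ Icc 0 T := Ioc_subset_Icc_self hx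
    have hd1 : HasDerivAt G (g x) x := h2 (hu ▸ hx') 0 h0
    have hd2 : HasDerivAt F (e x) x := (h3 (hu ▸ hx') 0 h0).const_add _
    have hFE : F x = E x := (hE x hx').symm
    have hd3 : HasDerivAt (fun t => Real.exp ((-1) * G t))
        (Real.exp ((-1) * G x) * ((-1) * g x)) x := (hd1.const_mul (-1)).exp
    simp only [Pi.zero_apply]
    rw [hd3.deriv, hd2.deriv, hFE]
    have := h1 hx'
    have hp := Real.exp_pos ((-1) * G x)
    nlinarith
  rw [key] at hneg
  have hG0 : G 0 = 0 := by simp [hG]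
  have hF0 : F 0 = E 0 := by simp [hF]
  have hFT : F T = E T := (hE T ⟨hT, le_rfl⟩).symm
  rw [hG0, hF0, hFT, mul_zero, Real.exp_zero, one_mul, sub_nonpos] at hneg
  calc E T = Real.exp (G T) * (Real.exp ((-1) * G T) * E T) := by
        rw [← mul_assoc, ← Real.exp_add]; simp
    _ ≤ Real.exp (G T) * E 0 := by gcongr

/-! ### Left-point sums and the Young integral -/

/-- `LeftSum y x δ a b σ` says that `σ` is the left-point sum `∑ y (p i) (x (p (i+1)) - x (p i))`
over some partition of `[a, b]` of mesh less than `δ`. The inductive form makes concatenation of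
partitions immediate. -/
inductive LeftSum (y x : ℝ → ℝ) (δ : ℝ) : ℝ → ℝ → ℝ → Prop
  | nil (a : ℝ) : LeftSum y x δ a a 0
  | cons {a c b σ : ℝ} : a ≤ c → c - a < δ → LeftSum y x δ c b σ →
      LeftSum y x δ a b (y a * (x c - x a) + σ)

namespace LeftSum

variable {y x : ℝ → ℝ} {δ a b c σ τ : ℝ}

lemma single (hab : a ≤ b) (h : b - a < δ) : LeftSum y x δ a b (y a * (x b - x a)) := by
  simpa using LeftSum.cons (y := y) (x := x) hab h (.nil b)

lemma append (h₁ : LeftSum y x δ a b σ) (h₂ : LeftSum y x δ b c τ) :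
    LeftSum y x δ a c (σ + τ) := by
  induction h₁ with
  | nil a => simpa using h₂
  | cons h h' _ ih => rw [add_assoc]; exact .cons h h' (ih h₂)

lemma mono {δ' : ℝ} (h : LeftSum y x δ a b σ) (hδ : δ ≤ δ') : LeftSum y x δ' a b σ := by
  induction h with
  | nil a => exact .nil a
  | cons h h' _ ih => exact .cons h (h'.trans_le hδ) ih

lemma exists_partition (h : LeftSum y x δ a b σ) :
    ∃ (n : ℕ) (p : ℕ → ℝ), p 0 = a ∧ p n = b ∧
      (∀ i < n, p i ≤ p (i + 1) ∧ p (i + 1) - p i < δ) ∧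
      ∑ i ∈ Finset.range n, y (p i) * (x (p (i + 1)) - x (p i)) = σ := by
  induction h with
  | nil a => exact ⟨0, fun _ => a, rfl, rfl, by simp, by simp⟩
  | @cons a c b σ h h' _ ih =>
    obtain ⟨n, p, h0, hn, hp, hs⟩ := ih
    refine ⟨n + 1, fun i => Nat.casesOn i a p, rfl, hn, ?_, ?_⟩
    · rintro (_ | i) hi
      · simpa [h0] using ⟨h, h'⟩
      · exact hp i (by omega)
    · rw [Finset.sum_range_succ']
      simp only [h0]
      rw [hs, add_comm]
      rfl

lemma exists_of_le (hδ : 0 < δ) (hab : a ≤ b) : ∃ σ, LeftSum y x δ a b σ := by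
  obtain ⟨n, hn⟩ := exists_nat_gt ((b - a) / (δ / 2))
  rw [div_lt_iff₀ (by positivity)] at hn
  induction n generalizing a with
  | zero => simp at hn; linarith
  | succ n ih =>
    rcases lt_or_ge (b - a) δ with h | h
    · exact ⟨_, single hab h⟩
    · obtain ⟨σ, hσ⟩ := ih (a := a + δ / 2) (by linarith) (by push_cast at hn; linarith)
      exact ⟨_, .cons (by linarith) (by linarith) hσ⟩

end LeftSum

/-- Any interval has partitions of arbitrarily small mesh. -/
lemma exists_partition_mesh_lt {a b δ : ℝ} (hδ : 0 < δ) (hab : a ≤ b) :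
    ∃ (n : ℕ) (p : ℕ → ℝ), p 0 = a ∧ p n = b ∧
      ∀ i < n, p i ≤ p (i + 1) ∧ p (i + 1) - p i < δ := by
  obtain ⟨σ, hσ⟩ := LeftSum.exists_of_le (y := 0) (x := 0) hδ hab
  obtain ⟨n, p, h0, hn, hp, -⟩ := hσ.exists_partition
  exact ⟨n, p, h0, hn, hp⟩

lemma HasYoungIntegral.exists_leftSum {y x : ℝ → ℝ} {a b I ε : ℝ} (h : HasYoungIntegral y x a b I)
    (hε : 0 < ε) : ∃ δ > 0, ∀ σ, LeftSum y x δ a b σ → |σ - I| < ε := by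
  obtain ⟨δ, hδ, hI⟩ := h ε hε
  refine ⟨δ, hδ, fun σ hσ => ?_⟩
  obtain ⟨n, p, h0, hn, hp, rfl⟩ := hσ.exists_partition
  exact hI n p h0 hn hp

/-- If all the integrals `J t = ∫₀ᵗ y dx` exist, fine left-point sums over `[s, t]` approximate
`J t - J s`. -/
lemma exists_leftSum_near_sub {y x J : ℝ → ℝ} {s t δ ε : ℝ} (h0 : 0 ≤ s) (hst : s ≤ t)
    (hs : HasYoungIntegral y x 0 s (J s)) (ht : HasYoungIntegral y x 0 t (J t))
    (hδ : 0 < δ) (hε : 0 < ε) : ∃ σ, LeftSum y x δ s t σ ∧ |σ - (J t - J s)| < ε := by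
  obtain ⟨δ₁, hδ₁, h1⟩ := hs.exists_leftSum (half_pos hε)
  obtain ⟨δ₂, hδ₂, h2⟩ := ht.exists_leftSum (half_pos hε)
  have hm : 0 < min δ (min δ₁ δ₂) := by positivity
  obtain ⟨σ, hσ⟩ := LeftSum.exists_of_le (y := y) (x := x) hm hst
  obtain ⟨τ, hτ⟩ := LeftSum.exists_of_le (y := y) (x := x) hm h0
  refine ⟨σ, hσ.mono (min_le_left _ _), ?_⟩
  have a1 := abs_lt.1 (h1 τ (hτ.mono ((min_le_right _ _).trans (min_le_left _ _))))
  have a2 := abs_lt.1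
    (h2 (τ + σ) ((hτ.append hσ).mono ((min_le_right _ _).trans (min_le_right _ _))))
  rw [abs_lt]
  constructor <;> linarith

section Partition

variable {n : ℕ} {p : ℕ → ℝ} {t T : ℝ}

lemma partition_mono (hp : ∀ i < n, p i ≤ p (i + 1)) {i j : ℕ} (hij : i ≤ j) (hj : j ≤ n) :
    p i ≤ p j := by
  induction j, hij using Nat.le_induction with
  | base => exact le_rfl
  | succ j _ ih => exact (ih (by omega)).trans (hp j (by omega))

lemma partition_mem_Icc (h0 : p 0 = 0) (hn : p n = t) (ht : t ≤ T)
    (hp : ∀ i < n, p i ≤ p (i + 1)) {i : ℕ} (hi : i ≤ n) : p i ∈ Icc 0 T :=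
  ⟨h0 ▸ partition_mono hp (Nat.zero_le i) hi, (hn ▸ partition_mono hp hi le_rfl).trans ht⟩

end Partition

/-- The Saks–Henstock lemma for left-point sums: if the Young integrals `J t = ∫₀ᵗ y dx` exist,
the errors `y(pᵢ) (x(pᵢ₊₁) - x(pᵢ)) - (J(pᵢ₊₁) - J(pᵢ))` of a fine partition are small in absolute
sum. No regularity of `y` is used: keeping only the intervals on which the error has a given sign,
and refining the partition on the others, changes the left-point sum by the sum of these errors up
to an arbitrarily small amount. -/
lemma HasYoungIntegral.saks_henstock {y x J : ℝ → ℝ} {T t : ℝ}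
    (hJ : ∀ t ∈ Icc 0 T, HasYoungIntegral y x 0 t (J t)) (ht : t ∈ Icc 0 T) {ε : ℝ} (hε : 0 < ε) :
    ∃ δ > 0, ∀ (n : ℕ) (p : ℕ → ℝ), p 0 = 0 → p n = t →
      (∀ i < n, p i ≤ p (i + 1) ∧ p (i + 1) - p i < δ) →
      ∑ i ∈ Finset.range n,
        |y (p i) * (x (p (i + 1)) - x (p i)) - (J (p (i + 1)) - J (p i))| ≤ ε := by
  obtain ⟨δ, hδ, hI⟩ := (hJ t ht).exists_leftSum (show 0 < ε / 4 by positivity)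
  have hJ0 : J 0 = 0 := by
    by_contra hne
    obtain ⟨δ', hδ', h⟩ := (hJ 0 ⟨le_rfl, ht.1.trans ht.2⟩).exists_leftSum (abs_pos.2 hne)
    have := h 0 (.nil 0)
    simp at this
  refine ⟨δ, hδ, fun n p h0 hn hp => ?_⟩
  have hmem : ∀ i ≤ n, p i ∈ Icc 0 T := fun i hi =>
    partition_mem_Icc h0 hn ht.2 (fun i hi => (hp i hi).1) hi
  set D : ℕ → ℝ := fun i => y (p i) * (x (p (i + 1)) - x (p i)) with hD
  set Q : ℕ → ℝ := fun i => J (p (i + 1)) - J (p i) with hQ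
  have hη : 0 < ε / 4 / (n + 1) := by positivity
  have key : ∀ (S : ℕ → Prop) [DecidablePred S],
      |∑ i ∈ Finset.range n, (if S i then D i - Q i else 0)| ≤ ε / 2 := by
    intro S _
    -- keep the interval `i` if `S i`, otherwise subdivide it until its sum is close to `Q i`
    have hk : ∀ k ≤ n, ∃ σ, LeftSum y x δ (p 0) (p k) σ ∧
        |σ - ∑ i ∈ Finset.range k, (if S i then D i else Q i)| ≤ k * (ε / 4 / (n + 1)) := by
      intro k hk
      induction k with
      | zero => exact ⟨0, .nil _, by simp⟩
      | succ k ih =>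
        obtain ⟨σ, hσ, hb⟩ := ih (by omega)
        obtain ⟨τ, hτ, hc⟩ : ∃ τ, LeftSum y x δ (p k) (p (k + 1)) τ ∧
            |τ - (if S k then D k else Q k)| ≤ ε / 4 / (n + 1) := by
          by_cases hS : S k
          · exact ⟨D k, .single (hp k (by omega)).1 (hp k (by omega)).2, by simp [hS, hη.le]⟩
          · obtain ⟨τ, h1, h2⟩ := exists_leftSum_near_sub (J := J) (hmem k (by omega)).1
              (hp k (by omega)).1 (hJ _ (hmem k (by omega))) (hJ _ (hmem (k + 1) hk)) hδ hη
            exact ⟨τ, h1, by simpa [hS] using h2.le⟩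
        refine ⟨σ + τ, hσ.append hτ, ?_⟩
        rw [Finset.sum_range_succ]
        rw [abs_le] at *
        push_cast
        constructor <;> linarith [hb.1, hb.2, hc.1, hc.2]
    obtain ⟨σ, hσ, hb⟩ := hk n le_rfl
    rw [h0, hn] at hσ
    have h1 := hI σ hσ
    have h2 : (n : ℝ) * (ε / 4 / (n + 1)) ≤ ε / 4 := by
      rw [mul_div_assoc', div_le_iff₀ (by positivity)]
      nlinarith
    have h3 : ∑ i ∈ Finset.range n, Q i = J t := by
      rw [hQ, Finset.sum_range_sub (fun i => J (p i)), hn, h0, hJ0, sub_zero]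
    have h4 : ∑ i ∈ Finset.range n, (if S i then D i - Q i else 0) =
        ∑ i ∈ Finset.range n, (if S i then D i else Q i) - J t := by
      rw [← h3, ← Finset.sum_sub_distrib]
      exact Finset.sum_congr rfl fun i _ => by split_ifs <;> ring
    rw [h4]
    rw [abs_lt] at h1
    rw [abs_le] at *
    constructor <;> linarith [hb.1, hb.2, h1.1, h1.2]
  -- nonnegative and negative errors are controlled separately
  have e1 := (abs_le.1 (key fun i => 0 ≤ D i - Q i)).2
  have e2 := (abs_le.1 (key fun i => ¬ 0 ≤ D i - Q i)).1
  have e3 : ∑ i ∈ Finset.range n, |D i - Q i| =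
      ∑ i ∈ Finset.range n, (if 0 ≤ D i - Q i then D i - Q i else 0) -
      ∑ i ∈ Finset.range n, (if ¬ 0 ≤ D i - Q i then D i - Q i else 0) := by
    rw [← Finset.sum_sub_distrib]
    refine Finset.sum_congr rfl fun i _ => ?_
    by_cases h : 0 ≤ D i - Q i
    · rw [if_pos h, if_neg (not_not.2 h), abs_of_nonneg h, sub_zero]
    · rw [if_neg h, if_pos h, abs_of_neg (not_le.1 h), zero_sub]
  change ∑ i ∈ Finset.range n, |D i - Q i| ≤ ε
  linarith

/-! ### The transformation by `exp (-β ω)` along a rough path -/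

/-- A path which is Hölder continuous with exponent above `1/2` has vanishing quadratic
variation. -/
lemma exists_sum_sq_sub_le {ω : ℝ → ℝ} {T : ℝ} {γ₁ K : ℝ≥0} (hγ₁ : 1 / 2 < γ₁)
    (hω : HolderOnWith K γ₁ ω (Icc 0 T)) {ε : ℝ} (hε : 0 < ε) :
    ∃ δ > 0, ∀ t ∈ Icc 0 T, ∀ (n : ℕ) (p : ℕ → ℝ), p 0 = 0 → p n = t →
      (∀ i < n, p i ≤ p (i + 1) ∧ p (i + 1) - p i < δ) →
      ∑ i ∈ Finset.range n, (ω (p (i + 1)) - ω (p i)) ^ 2 ≤ ε := by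
  have hγ : (0 : ℝ) < 2 * γ₁ - 1 := by
    have : (1 / 2 : ℝ) < γ₁ := by exact_mod_cast hγ₁
    linarith
  have hlim : Tendsto (fun d : ℝ => (K : ℝ) ^ 2 * d ^ (2 * (γ₁ : ℝ) - 1) * T) (𝓝 0) (𝓝 0) := by
    have h1 : Tendsto (fun d : ℝ => d ^ (2 * (γ₁ : ℝ) - 1)) (𝓝 0) (𝓝 0) := by
      have := (Real.continuousAt_rpow_const 0 (2 * (γ₁ : ℝ) - 1) (Or.inr hγ.le)).tendsto
      rwa [Real.zero_rpow hγ.ne'] at this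
    simpa using (h1.const_mul ((K : ℝ) ^ 2)).mul_const T
  obtain ⟨δ, hδ, h⟩ := Metric.eventually_nhds_iff.1 (hlim.eventually (gt_mem_nhds hε))
  refine ⟨δ / 2, by positivity, fun t ht n p h0 hn hp => ?_⟩
  have hmem : ∀ i ≤ n, p i ∈ Icc 0 T := fun i hi =>
    partition_mem_Icc h0 hn ht.2 (fun i hi => (hp i hi).1) hi
  have hb := h (y := δ / 2) (by rw [dist_zero_right, Real.norm_of_nonneg] <;> linarith)
  refine le_trans ?_ hb.le
  calc ∑ i ∈ Finset.range n, (ω (p (i + 1)) - ω (p i)) ^ 2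
      ≤ ∑ i ∈ Finset.range n,
          (K : ℝ) ^ 2 * (δ / 2) ^ (2 * (γ₁ : ℝ) - 1) * (p (i + 1) - p i) := by
        refine Finset.sum_le_sum fun i hi => ?_
        have hi := Finset.mem_range.1 hi
        have hd := hω.dist_le (hmem (i + 1) hi) (hmem i hi.le)
        obtain ⟨h1, h2⟩ := hp i hi
        rw [Real.dist_eq, Real.dist_eq, abs_of_nonneg (sub_nonneg.2 h1)] at hd
        have hx : 0 ≤ p (i + 1) - p i := sub_nonneg.2 h1
        generalize p (i + 1) - p i = d at *
        rw [← sq_abs]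
        calc |ω (p (i + 1)) - ω (p i)| ^ 2 ≤ (K * d ^ (γ₁ : ℝ)) ^ 2 := by gcongr
          _ = K ^ 2 * (d ^ (2 * (γ₁ : ℝ) - 1) * d) := by
            rw [mul_pow, ← Real.rpow_natCast (d ^ (γ₁ : ℝ)), ← Real.rpow_mul hx]
            nth_rewrite 3 [← Real.rpow_one d]
            rw [← Real.rpow_add_of_nonneg hx hγ.le zero_le_one]
            congr 2
            push_cast
            ring
          _ ≤ K ^ 2 * ((δ / 2) ^ (2 * (γ₁ : ℝ) - 1) * d) := by gcongr
          _ = _ := by ring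
    _ = (K : ℝ) ^ 2 * (δ / 2) ^ (2 * (γ₁ : ℝ) - 1) * t := by
        rw [← Finset.mul_sum, Finset.sum_range_sub, h0, hn, sub_zero]
    _ ≤ _ := by
        have := ht.2
        gcongr

/-- The increment of `z X`, `z = exp (-β ω)`, against that of `X`, up to an error which is second
order in the increment of `ω`, plus the oscillation of `z` integrated against `|a|`. -/
lemma abs_exp_mul_increment_sub_le {ω X a : ℝ → ℝ} {β s t B Z ε : ℝ} (hst : s ≤ t)
    (hu : |β * (ω t - ω s)| ≤ 1) (hX : |X s| ≤ B)
    (hZ : Real.exp (-β * ω t) ≤ Z) (ha : IntervalIntegrable a volume s t)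
    (hza : IntervalIntegrable (fun r => Real.exp (-β * ω r) * a r) volume s t)
    (hosc : ∀ r ∈ Icc s t, |Real.exp (-β * ω t) - Real.exp (-β * ω r)| ≤ ε) :
    |Real.exp (-β * ω t) * (X t - X s - (∫ r in s..t, a r) - β * X s * (ω t - ω s)) -
      (Real.exp (-β * ω t) * X t - Real.exp (-β * ω s) * X s -
        ∫ r in s..t, Real.exp (-β * ω r) * a r)| ≤
      Z * B * β ^ 2 * (ω t - ω s) ^ 2 + ε * ∫ r in s..t, |a r| := by
  set u := β * (ω t - ω s) with hu'
  have hzs : Real.exp (-β * ω s) = Real.exp (-β * ω t) * Real.exp u := by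
    rw [← Real.exp_add]; congr 1; rw [hu']; ring
  have hint : Real.exp (-β * ω t) * (∫ r in s..t, a r) - ∫ r in s..t, Real.exp (-β * ω r) * a r =
      ∫ r in s..t, (Real.exp (-β * ω t) - Real.exp (-β * ω r)) * a r := by
    rw [← intervalIntegral.integral_const_mul,
      ← intervalIntegral.integral_sub (ha.const_mul _) hza]
    simp only [sub_mul]
  have heq : Real.exp (-β * ω t) * (X t - X s - (∫ r in s..t, a r) - β * X s * (ω t - ω s)) -
      (Real.exp (-β * ω t) * X t - Real.exp (-β * ω s) * X s -
        ∫ r in s..t, Real.exp (-β * ω r) * a r) =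
      Real.exp (-β * ω t) * X s * (Real.exp u - 1 - u) -
        ∫ r in s..t, (Real.exp (-β * ω t) - Real.exp (-β * ω r)) * a r := by
    rw [← hint, hzs, hu']; ring
  have h1 : |Real.exp (-β * ω t) * X s * (Real.exp u - 1 - u)| ≤
      Z * B * β ^ 2 * (ω t - ω s) ^ 2 := by
    rw [abs_mul, abs_mul, abs_of_pos (Real.exp_pos _)]
    calc _ ≤ Z * B * u ^ 2 := by
          have := Real.abs_exp_sub_one_sub_id_le hu
          have hZ0 := (Real.exp_pos _).le.trans hZ
          have hB0 := (abs_nonneg _).trans hX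
          gcongr
      _ = _ := by rw [hu']; ring
  have h2 : |∫ r in s..t, (Real.exp (-β * ω t) - Real.exp (-β * ω r)) * a r| ≤
      ε * ∫ r in s..t, |a r| := by
    rw [← intervalIntegral.integral_const_mul, ← Real.norm_eq_abs]
    refine intervalIntegral.norm_integral_le_of_norm_le hst ?_ (ha.abs.const_mul ε)
    refine ae_of_all _ fun r hr => ?_
    rw [norm_mul, Real.norm_eq_abs, Real.norm_eq_abs]
    exact mul_le_mul_of_nonneg_right (hosc r (Ioc_subset_Icc_self hr)) (abs_nonneg _)
  rw [heq]
  exact (abs_sub _ _).trans (add_le_add h1 h2)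

/-- On fine partitions, the errors of the equations `dX = a dt + β X dω` and `dy = z a dt`,
`y = z X`, `z = exp (-β ω)`, agree up to the factor `z`, in absolute sum. -/
lemma exists_sum_abs_exp_mul_increment_sub_le {ω X a : ℝ → ℝ} {β T : ℝ} (hT : 0 ≤ T)
    {γ₁ K : ℝ≥0} (hγ₁ : 1 / 2 < γ₁) (hω : HolderOnWith K γ₁ ω (Icc 0 T))
    (hX : ContinuousOn X (Icc 0 T)) (ha : IntervalIntegrable a volume 0 T)
    {ε : ℝ} (hε : 0 < ε) :
    ∃ δ > 0, ∀ t ∈ Icc 0 T, ∀ (n : ℕ) (p : ℕ → ℝ), p 0 = 0 → p n = t →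
      (∀ i < n, p i ≤ p (i + 1) ∧ p (i + 1) - p i < δ) →
      ∑ i ∈ Finset.range n, |Real.exp (-β * ω (p (i + 1))) *
        (X (p (i + 1)) - X (p i) - (∫ r in p i..p (i + 1), a r) -
          β * X (p i) * (ω (p (i + 1)) - ω (p i))) -
        (Real.exp (-β * ω (p (i + 1))) * X (p (i + 1)) - Real.exp (-β * ω (p i)) * X (p i) -
          ∫ r in p i..p (i + 1), Real.exp (-β * ω r) * a r)| ≤ ε := by
  have hγ0 : 0 < γ₁ := lt_trans (by norm_num) hγ₁
  have hωc : ContinuousOn ω (Icc 0 T) := hω.continuousOn hγ0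
  have hzc : ContinuousOn (fun r => Real.exp (-β * ω r)) (Icc 0 T) :=
    (continuousOn_const.mul hωc).rexp
  have hza : IntervalIntegrable (fun r => Real.exp (-β * ω r) * a r) volume 0 T :=
    ha.continuousOn_mul (by rwa [uIcc_of_le hT])
  obtain ⟨B, hB⟩ := isCompact_Icc.exists_bound_of_continuousOn hX
  obtain ⟨Z, hZ⟩ := isCompact_Icc.exists_bound_of_continuousOn hzc
  have hB0 : 0 ≤ B := (norm_nonneg _).trans (hB 0 ⟨le_rfl, hT⟩)
  have hZ0 : 0 ≤ Z := (norm_nonneg _).trans (hZ 0 ⟨le_rfl, hT⟩)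
  set N := ∫ r in (0 : ℝ)..T, |a r| with hN
  have hN0 : 0 ≤ N := intervalIntegral.integral_nonneg hT fun _ _ => abs_nonneg _
  obtain ⟨δ₁, hδ₁, h1⟩ := exists_sum_sq_sub_le hγ₁ hω
    (show 0 < ε / 2 / (Z * B * β ^ 2 + 1) by positivity)
  have hβω : ContinuousOn (fun r => β * ω r) (Icc 0 T) := continuousOn_const.mul hωc
  obtain ⟨δ₂, hδ₂, h2⟩ := Metric.uniformContinuousOn_iff_le.1
    (isCompact_Icc.uniformContinuousOn_of_continuous hβω) 1 one_pos
  obtain ⟨δ₃, hδ₃, h3⟩ := Metric.uniformContinuousOn_iff_le.1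
    (isCompact_Icc.uniformContinuousOn_of_continuous hzc) (ε / 2 / (N + 1)) (by positivity)
  refine ⟨min δ₁ (min δ₂ δ₃), by positivity, fun t ht n p h0 hn hp => ?_⟩
  have hmem : ∀ i ≤ n, p i ∈ Icc 0 T := fun i hi =>
    partition_mem_Icc h0 hn ht.2 (fun i hi => (hp i hi).1) hi
  have hsub : ∀ i < n, Icc (p i) (p (i + 1)) ⊆ Icc 0 T := fun i hi =>
    Icc_subset_Icc (hmem i hi.le).1 (hmem (i + 1) hi).2
  have hii : ∀ {f : ℝ → ℝ}, IntervalIntegrable f volume 0 T → ∀ i < n,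
      IntervalIntegrable f volume (p i) (p (i + 1)) := fun hf i hi =>
    hf.mono_set (by rw [uIcc_of_le (hp i hi).1, uIcc_of_le hT]; exact hsub i hi)
  calc _ ≤ ∑ i ∈ Finset.range n, (Z * B * β ^ 2 * (ω (p (i + 1)) - ω (p i)) ^ 2 +
        ε / 2 / (N + 1) * ∫ r in p i..p (i + 1), |a r|) := by
        refine Finset.sum_le_sum fun i hi => ?_
        have hi := Finset.mem_range.1 hi
        have hlt := (hp i hi).2
        rw [lt_min_iff, lt_min_iff] at hlt
        have hle := (hp i hi).1
        refine abs_exp_mul_increment_sub_le hle ?_ (hB _ (hmem i hi.le))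
          ((le_abs_self _).trans (hZ _ (hmem (i + 1) hi))) (hii ha i hi) (hii hza i hi) ?_
        · have := h2 _ (hmem (i + 1) hi) _ (hmem i hi.le)
            (by rw [Real.dist_eq, abs_of_nonneg (by linarith)]; exact hlt.2.1.le)
          rwa [Real.dist_eq, ← mul_sub] at this
        · intro r hr
          refine h3 _ (hmem (i + 1) hi) _ (hsub i hi hr) ?_
          rw [Real.dist_eq, abs_of_nonneg (by linarith [hr.2])]
          linarith [hr.1, hlt.2.2]
    _ = Z * B * β ^ 2 * ∑ i ∈ Finset.range n, (ω (p (i + 1)) - ω (p i)) ^ 2 +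
        ε / 2 / (N + 1) * ∫ r in (0 : ℝ)..t, |a r| := by
        rw [Finset.sum_add_distrib, ← Finset.mul_sum, ← Finset.mul_sum,
          intervalIntegral.sum_integral_adjacent_intervals fun i hi => hii ha.abs i hi, h0, hn]
    _ ≤ Z * B * β ^ 2 * (ε / 2 / (Z * B * β ^ 2 + 1)) + ε / 2 / (N + 1) * N := by
        have e1 := h1 t ht n p h0 hn fun i hi =>
          ⟨(hp i hi).1, (hp i hi).2.trans_le (min_le_left _ _)⟩
        have e2 : ∫ r in (0 : ℝ)..t, |a r| ≤ N := by
          refine intervalIntegral.integral_mono_interval le_rfl ht.1 ht.2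
            (ae_of_all _ fun _ => abs_nonneg _) ha.abs
        gcongr
    _ ≤ ε / 2 + ε / 2 := by
        gcongr
        · rw [mul_div_assoc', div_le_iff₀ (by positivity)]
          nlinarith
        · rw [div_mul_eq_mul_div, div_le_iff₀ (by positivity)]
          nlinarith
    _ = ε := by ring

/-- If `y = z X` with `z = exp (-β ω)` has the increments `∫ z a`, then `X` solves
`dX = a dt + β X dω` with a Young integral. -/
lemma hasYoungIntegral_of_exp_mul {ω X a : ℝ → ℝ} {β T : ℝ}
    {γ₁ K : ℝ≥0} (hγ₁ : 1 / 2 < γ₁) (hω : HolderOnWith K γ₁ ω (Icc 0 T))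
    (hX : ContinuousOn X (Icc 0 T)) (ha : IntervalIntegrable a volume 0 T)
    (hy : ∀ t ∈ Icc 0 T, Real.exp (-β * ω t) * X t = Real.exp (-β * ω 0) * X 0 +
      ∫ r in (0 : ℝ)..t, Real.exp (-β * ω r) * a r) {t : ℝ} (ht : t ∈ Icc 0 T) :
    HasYoungIntegral (fun r => β * X r) ω 0 t (X t - X 0 - ∫ r in (0 : ℝ)..t, a r) := by
  have hT : 0 ≤ T := ht.1.trans ht.2
  have hωc : ContinuousOn ω (Icc 0 T) := hω.continuousOn (lt_trans (by norm_num) hγ₁)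
  have hza : IntervalIntegrable (fun r => Real.exp (-β * ω r) * a r) volume 0 T :=
    ha.continuousOn_mul (by rw [uIcc_of_le hT]; exact (continuousOn_const.mul hωc).rexp)
  have hzinv : ContinuousOn (fun r => Real.exp (β * ω r)) (Icc 0 T) :=
    (continuousOn_const.mul hωc).rexp
  obtain ⟨Z, hZ⟩ := isCompact_Icc.exists_bound_of_continuousOn hzinv
  have hZ0 : 0 ≤ Z := (norm_nonneg _).trans (hZ 0 ⟨le_rfl, hT⟩)
  intro ε hε
  obtain ⟨δ, hδ, h⟩ := exists_sum_abs_exp_mul_increment_sub_le (β := β) hT hγ₁ hω hX ha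
    (show 0 < ε / (Z + 1) by positivity)
  refine ⟨δ, hδ, fun n p h0 hn hp => ?_⟩
  have hmem : ∀ i ≤ n, p i ∈ Icc 0 T := fun i hi =>
    partition_mem_Icc h0 hn ht.2 (fun i hi => (hp i hi).1) hi
  have hii : ∀ {f : ℝ → ℝ}, IntervalIntegrable f volume 0 T → ∀ i < n,
      IntervalIntegrable f volume (p i) (p (i + 1)) := fun hf i hi =>
    hf.mono_set (by
      rw [uIcc_of_le (hp i hi).1, uIcc_of_le hT]
      exact Icc_subset_Icc (hmem i hi.le).1 (hmem (i + 1) hi).2)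
  have hi0 : ∀ {f : ℝ → ℝ}, IntervalIntegrable f volume 0 T → ∀ s ∈ Icc 0 T,
      IntervalIntegrable f volume 0 s := fun hf s hs =>
    hf.mono_set (by rw [uIcc_of_le hs.1, uIcc_of_le hT]; exact Icc_subset_Icc le_rfl hs.2)
  set D : ℕ → ℝ := fun i => X (p (i + 1)) - X (p i) - (∫ r in p i..p (i + 1), a r) -
          β * X (p i) * (ω (p (i + 1)) - ω (p i)) with hD
  have hbound : ∑ i ∈ Finset.range n, |Real.exp (-β * ω (p (i + 1))) * D i| ≤ ε / (Z + 1) := by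
    refine le_trans (Finset.sum_le_sum fun i hi => ?_) (h t ht n p h0 hn hp)
    have hi := Finset.mem_range.1 hi
    have e := intervalIntegral.integral_interval_sub_left (hi0 hza _ (hmem (i + 1) hi))
      (hi0 hza _ (hmem i hi.le))
    rw [hy _ (hmem (i + 1) hi), hy _ (hmem i hi.le), ← e]
    apply le_of_eq
    congr 1
    ring
  have hsum : ∑ i ∈ Finset.range n, β * X (p i) * (ω (p (i + 1)) - ω (p i)) -
      (X t - X 0 - ∫ r in (0 : ℝ)..t, a r) = - ∑ i ∈ Finset.range n, D i := by
    rw [hD, Finset.sum_sub_distrib, Finset.sum_sub_distrib,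
      Finset.sum_range_sub (fun i => X (p i)),
      intervalIntegral.sum_integral_adjacent_intervals fun i hi => hii ha i hi, h0, hn]
    ring
  rw [hsum, abs_neg]
  calc |∑ i ∈ Finset.range n, D i| ≤ ∑ i ∈ Finset.range n, |D i| := Finset.abs_sum_le_sum_abs _ _
    _ ≤ ∑ i ∈ Finset.range n, Z * |Real.exp (-β * ω (p (i + 1))) * D i| := by
        refine Finset.sum_le_sum fun i hi => ?_
        have hi := Finset.mem_range.1 hi
        have hz := (le_abs_self _).trans (hZ _ (hmem (i + 1) hi))
        rw [abs_mul, abs_of_pos (Real.exp_pos _), ← mul_assoc]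
        have : Real.exp (β * ω (p (i + 1))) * Real.exp (-β * ω (p (i + 1))) = 1 := by
          rw [← Real.exp_add]; simp
        calc |D i| = Real.exp (β * ω (p (i + 1))) * Real.exp (-β * ω (p (i + 1))) * |D i| := by
              rw [this, one_mul]
          _ ≤ _ := by gcongr
    _ = Z * ∑ i ∈ Finset.range n, |Real.exp (-β * ω (p (i + 1))) * D i| := by rw [Finset.mul_sum]
    _ ≤ Z * (ε / (Z + 1)) := by gcongr
    _ < ε := by
        rw [mul_div_assoc', div_lt_iff₀ (by positivity)]
        nlinarith

/-- Conversely, if the continuous function `X` solves `dX = a dt + β X dω` with Young integrals,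
then `z X`, `z = exp (-β ω)`, has the increments `∫ z a`. -/
lemma exp_mul_eq_of_hasYoungIntegral {ω X a : ℝ → ℝ} {β T : ℝ}
    {γ₁ K : ℝ≥0} (hγ₁ : 1 / 2 < γ₁) (hω : HolderOnWith K γ₁ ω (Icc 0 T))
    (hX : ContinuousOn X (Icc 0 T)) (ha : IntervalIntegrable a volume 0 T)
    (hI : ∀ t ∈ Icc 0 T, HasYoungIntegral (fun r => β * X r) ω 0 t
      (X t - X 0 - ∫ r in (0 : ℝ)..t, a r)) {t : ℝ} (ht : t ∈ Icc 0 T) :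
    Real.exp (-β * ω t) * X t = Real.exp (-β * ω 0) * X 0 +
      ∫ r in (0 : ℝ)..t, Real.exp (-β * ω r) * a r := by
  have hT : 0 ≤ T := ht.1.trans ht.2
  have hωc : ContinuousOn ω (Icc 0 T) := hω.continuousOn (lt_trans (by norm_num) hγ₁)
  have hzc : ContinuousOn (fun r => Real.exp (-β * ω r)) (Icc 0 T) :=
    (continuousOn_const.mul hωc).rexp
  have hza : IntervalIntegrable (fun r => Real.exp (-β * ω r) * a r) volume 0 T :=
    ha.continuousOn_mul (by rwa [uIcc_of_le hT])
  obtain ⟨Z, hZ⟩ := isCompact_Icc.exists_bound_of_continuousOn hzc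
  have hZ0 : 0 ≤ Z := (norm_nonneg _).trans (hZ 0 ⟨le_rfl, hT⟩)
  rw [← sub_eq_zero, ← abs_nonpos_iff]
  refine le_of_forall_pos_le_add fun ε hε => ?_
  rw [zero_add]
  obtain ⟨δ₁, hδ₁, h1⟩ := exists_sum_abs_exp_mul_increment_sub_le (β := β) hT hγ₁ hω hX ha
    (half_pos hε)
  obtain ⟨δ₂, hδ₂, h2⟩ := HasYoungIntegral.saks_henstock
    (J := fun t => X t - X 0 - ∫ r in (0 : ℝ)..t, a r) hI ht
    (show 0 < ε / 2 / (Z + 1) by positivity)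
  obtain ⟨n, p, h0, hn, hp⟩ := exists_partition_mesh_lt (lt_min hδ₁ hδ₂) ht.1
  have hmem : ∀ i ≤ n, p i ∈ Icc 0 T := fun i hi =>
    partition_mem_Icc h0 hn ht.2 (fun i hi => (hp i hi).1) hi
  have hii : ∀ {f : ℝ → ℝ}, IntervalIntegrable f volume 0 T → ∀ i < n,
      IntervalIntegrable f volume (p i) (p (i + 1)) := fun hf i hi =>
    hf.mono_set (by
      rw [uIcc_of_le (hp i hi).1, uIcc_of_le hT]
      exact Icc_subset_Icc (hmem i hi.le).1 (hmem (i + 1) hi).2)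
  have hi0 : ∀ {f : ℝ → ℝ}, IntervalIntegrable f volume 0 T → ∀ s ∈ Icc 0 T,
      IntervalIntegrable f volume 0 s := fun hf s hs =>
    hf.mono_set (by rw [uIcc_of_le hs.1, uIcc_of_le hT]; exact Icc_subset_Icc le_rfl hs.2)
  have e1 := h1 t ht n p h0 hn fun i hi => ⟨(hp i hi).1, (hp i hi).2.trans_le (min_le_left _ _)⟩
  have e2 := h2 n p h0 hn fun i hi => ⟨(hp i hi).1, (hp i hi).2.trans_le (min_le_right _ _)⟩
  set D : ℕ → ℝ := fun i => X (p (i + 1)) - X (p i) - (∫ r in p i..p (i + 1), a r) -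
          β * X (p i) * (ω (p (i + 1)) - ω (p i)) with hD
  set Y : ℕ → ℝ := fun i => Real.exp (-β * ω (p (i + 1))) * X (p (i + 1)) -
    Real.exp (-β * ω (p i)) * X (p i) - ∫ r in p i..p (i + 1), Real.exp (-β * ω r) * a r with hY
  have e3 : ∑ i ∈ Finset.range n, |D i| ≤ ε / 2 / (Z + 1) := by
    refine le_trans (Finset.sum_le_sum fun i hi => ?_) e2
    have hi := Finset.mem_range.1 hi
    have e := intervalIntegral.integral_interval_sub_left (hi0 ha _ (hmem (i + 1) hi))
      (hi0 ha _ (hmem i hi.le))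
    rw [hD, ← abs_neg]
    simp only
    rw [← e]
    apply le_of_eq
    congr 1
    ring
  have hsum : Real.exp (-β * ω t) * X t - (Real.exp (-β * ω 0) * X 0 +
      ∫ r in (0 : ℝ)..t, Real.exp (-β * ω r) * a r) = ∑ i ∈ Finset.range n, Y i := by
    rw [hY, Finset.sum_sub_distrib,
      Finset.sum_range_sub (fun i => Real.exp (-β * ω (p i)) * X (p i)),
      intervalIntegral.sum_integral_adjacent_intervals fun i hi => hii hza i hi, h0, hn]
    ring
  rw [hsum]
  calc |∑ i ∈ Finset.range n, Y i| ≤ ∑ i ∈ Finset.range n, |Y i| := Finset.abs_sum_le_sum_abs _ _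
    _ ≤ ∑ i ∈ Finset.range n,
        (|Real.exp (-β * ω (p (i + 1))) * D i - Y i| + Z * |D i|) := by
        refine Finset.sum_le_sum fun i hi => ?_
        have hi := Finset.mem_range.1 hi
        have hz := (le_abs_self _).trans (hZ _ (hmem (i + 1) hi))
        have t1 := abs_sub_abs_le_abs_sub (Y i) (Real.exp (-β * ω (p (i + 1))) * D i)
        rw [abs_sub_comm (Y i), abs_mul (Real.exp _), abs_of_pos (Real.exp_pos _)] at t1
        have t2 : Real.exp (-β * ω (p (i + 1))) * |D i| ≤ Z * |D i| := by gcongr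
        linarith
    _ = ∑ i ∈ Finset.range n, |Real.exp (-β * ω (p (i + 1))) * D i - Y i| +
        Z * ∑ i ∈ Finset.range n, |D i| := by rw [Finset.sum_add_distrib, Finset.mul_sum]
    _ ≤ ε / 2 + Z * (ε / 2 / (Z + 1)) := by gcongr
    _ ≤ ε / 2 + ε / 2 := by
        gcongr
        rw [mul_div_assoc', div_le_iff₀ (by positivity)]
        nlinarith
    _ = ε := by ring

/-! ### The energy equality -/

/-- Translations act continuously on `L^p` and `L^q`, hence so does the pairing of two
translates. -/
lemma continuous_setIntegral_bilin_translate {E F : Type*} [NormedAddCommGroup E] [NormedSpace ℝ E]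
    [NormedAddCommGroup F] [NormedSpace ℝ F] (B : E →L[ℝ] F →L[ℝ] ℝ) {p q : ℝ≥0∞}
    [ENNReal.HolderConjugate q p] (hp : p ≠ ∞) (hq : q ≠ ∞) {f : ℝ → E} {g : ℝ → F}
    (hf : MemLp f q volume) (hg : MemLp g p volume) (S : Set ℝ) :
    Continuous fun z : ℝ × ℝ => ∫ s in S, B (f (z.1 + s)) (g (z.2 + s)) := by
  have : Fact (1 ≤ p) := ⟨ENNReal.HolderTriple.le p q 1⟩
  have : Fact (1 ≤ q) := ⟨ENNReal.HolderTriple.le q p 1⟩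
  have : Fact (p ≠ ∞) := ⟨hp⟩
  have : Fact (q ≠ ∞) := ⟨hq⟩
  have h : Continuous fun z : ℝ × ℝ => ∫ s in S, (B.holderL volume q p 1
      (DomAddAct.mk z.1 +ᵥ hf.toLp f) (DomAddAct.mk z.2 +ᵥ hg.toLp g) : Lp ℝ 1 volume) s := by
    refine (continuous_setIntegral S).comp ?_
    have h1 : Continuous fun z : ℝ × ℝ => DomAddAct.mk z.1 +ᵥ hf.toLp f :=
      (DomAddAct.continuous_mk.comp continuous_fst).vadd continuous_const
    have h2 : Continuous fun z : ℝ × ℝ => DomAddAct.mk z.2 +ᵥ hg.toLp g :=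
      (DomAddAct.continuous_mk.comp continuous_snd).vadd continuous_const
    exact ((B.holderL volume q p 1).continuous.comp h1).clm_apply h2
  refine h.congr fun z => ?_
  refine integral_congr_ae (ae_restrict_of_ae ?_)
  rw [DomAddAct.mk_vadd_toLp, DomAddAct.mk_vadd_toLp]
  filter_upwards [B.coeFn_holder (r := 1)
    ((hf.comp_measurePreserving (measurePreserving_vadd z.1 volume)).toLp (fun s => f (z.1 +ᵥ s)))
    ((hg.comp_measurePreserving (measurePreserving_vadd z.2 volume)).toLp (fun s => g (z.2 +ᵥ s))),
    (hf.comp_measurePreserving (measurePreserving_vadd z.1 volume)).coeFn_toLp,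
    (hg.comp_measurePreserving (measurePreserving_vadd z.2 volume)).coeFn_toLp] with s h1 h2 h3
  exact h1.trans (congrArg₂ (fun a b => B a b) h2 h3)

lemma integrable_bilin_of_memLp {X E F : Type*} [MeasurableSpace X] {μ : Measure X}
    [NormedAddCommGroup E] [NormedSpace ℝ E]
    [NormedAddCommGroup F] [NormedSpace ℝ F] (B : E →L[ℝ] F →L[ℝ] ℝ) {p q : ℝ≥0∞}
    [ENNReal.HolderConjugate q p] {f : X → E} {g : X → F}
    (hf : MemLp f q μ) (hg : MemLp g p μ) : Integrable (fun s => B (f s) (g s)) μ :=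
  memLp_one_iff_integrable.1 (B.memLp_of_bilin 1 hf hg)

/-- Integrability for Fubini's theorem. The dominating function `‖f(σ + s)‖ ‖g(s)‖` is integrable
since its integral over `s` is continuous in `σ`. -/
lemma integrable_prod_bilin_translate {E F : Type*} [NormedAddCommGroup E] [NormedSpace ℝ E]
    [NormedAddCommGroup F] [NormedSpace ℝ F] (B : E →L[ℝ] F →L[ℝ] ℝ) {p q : ℝ≥0∞}
    [ENNReal.HolderConjugate q p] (hp : p ≠ ∞) (hq : q ≠ ∞) {f : ℝ → E} {g : ℝ → F}
    (hfm : StronglyMeasurable f) (hgm : StronglyMeasurable g)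
    (hf : MemLp f q volume) (hg : MemLp g p volume) (t h : ℝ) :
    Integrable (fun z : ℝ × ℝ => B (f (z.2 + z.1)) (g z.1))
      ((volume.restrict (Ioc 0 t)).prod (volume.restrict (Ioc 0 h))) := by
  have m1 : StronglyMeasurable fun z : ℝ × ℝ => f (z.2 + z.1) :=
    hfm.comp_measurable (measurable_snd.add measurable_fst)
  have m2 : StronglyMeasurable fun z : ℝ × ℝ => g z.1 := hgm.comp_measurable measurable_fst
  have hdom : Integrable (fun z : ℝ × ℝ => ‖f (z.2 + z.1)‖ * ‖g z.1‖)
      ((volume.restrict (Ioc 0 t)).prod (volume.restrict (Ioc 0 h))) := by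
    have m3 : StronglyMeasurable fun z : ℝ × ℝ => ‖f (z.2 + z.1)‖ * ‖g z.1‖ :=
      m1.norm.mul m2.norm
    rw [integrable_prod_iff' m3.aestronglyMeasurable]
    constructor
    · refine ae_of_all _ fun σ => ?_
      exact (integrable_bilin_of_memLp (ContinuousLinearMap.mul ℝ ℝ)
        (hf.comp_measurePreserving (measurePreserving_add_left volume σ)).norm
        hg.norm).restrict
    · have hc := (continuous_setIntegral_bilin_translate (ContinuousLinearMap.mul ℝ ℝ) hp hq
        hf.norm hg.norm (Ioc 0 t)).comp (Continuous.prodMk_left (0 : ℝ))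
      have hc' : Continuous fun σ : ℝ => ∫ s in Ioc 0 t, ‖‖f (σ + s)‖ * ‖g s‖‖ := by
        simpa [Function.comp_def] using hc
      exact (hc'.integrableOn_Icc (a := 0) (b := h)).mono_set Ioc_subset_Icc_self
  refine (hdom.const_mul ‖B‖).mono'
    (B.aestronglyMeasurable_comp₂ m1.aestronglyMeasurable m2.aestronglyMeasurable)
    (ae_of_all _ fun z => ?_)
  rw [← mul_assoc]
  exact B.le_opNorm₂ _ _

lemma abs_integral_sub_mul_le {g : ℝ → ℝ} {a h c ε : ℝ} (hh : 0 ≤ h)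
    (hg : IntervalIntegrable g volume a (a + h)) (hb : ∀ r ∈ Ioc a (a + h), |g r - c| ≤ ε) :
    |(∫ r in a..(a + h), g r) - h * c| ≤ ε * h := by
  have e : (∫ r in a..(a + h), g r) - h * c = ∫ r in a..(a + h), (g r - c) := by
    rw [intervalIntegral.integral_sub hg intervalIntegrable_const]
    simp
  rw [e, ← Real.norm_eq_abs]
  have := intervalIntegral.norm_integral_le_of_norm_le_const (a := a) (b := a + h) (C := ε)
    (f := fun r => g r - c) (by rwa [uIoc_of_le (by linarith)])
  rwa [add_sub_cancel_left, abs_of_nonneg hh] at this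

/-- A function in `L^p(0,T)` has a strongly measurable version in `L^p(ℝ)`, namely its extension by
zero. -/
lemma MeasureTheory.MemLp.exists_stronglyMeasurable_extension {E : Type*} [NormedAddCommGroup E]
    {p : ℝ≥0∞} {T : ℝ} {f : ℝ → E} (hf : MemLp f p (volume.restrict (Icc 0 T))) :
    ∃ f' : ℝ → E, StronglyMeasurable f' ∧ MemLp f' p volume ∧
      ∀ᵐ r ∂(volume.restrict (Icc 0 T)), f' r = f r := by
  refine ⟨(Icc 0 T).indicator (hf.1.mk f), hf.1.stronglyMeasurable_mk.indicator measurableSet_Icc,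
    (memLp_indicator_iff_restrict measurableSet_Icc).2 (hf.ae_eq hf.1.ae_eq_mk), ?_⟩
  filter_upwards [hf.1.ae_eq_mk, ae_restrict_mem measurableSet_Icc] with r h1 h2
  rw [indicator_of_mem h2, h1]

section Energy

variable {H : Type*} [NormedAddCommGroup H] [InnerProductSpace ℝ H]
variable {V : Type*} [NormedAddCommGroup V] [NormedSpace ℝ V]
variable {ι : V →L[ℝ] H} {p q : ℝ≥0∞} {f : ℝ → StrongDual ℝ V} {W : ℝ → V} {w : ℝ → H} {T : ℝ}

lemma intervalIntegrable_apply_of_memLp (hq1 : 1 ≤ q) (hf : MemLp f q volume) (v : V) (a b : ℝ) :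
    IntervalIntegrable (fun r => f r v) volume a b := by
  have h1 : ∀ S : Set ℝ, volume S ≠ ∞ → IntegrableOn (fun r => f r v) S := fun S hS => by
    have : IsFiniteMeasure (volume.restrict S) := ⟨by simpa using hS.lt_top⟩
    have : Integrable f (volume.restrict S) := (hf.restrict S).integrable hq1
    exact this.apply_continuousLinearMap v
  exact ⟨h1 _ (by simp), h1 _ (by simp)⟩

/-- The identity `‖w(s+h)‖² - ‖w(s)‖² = ⟪w(s+h) - w(s), w(s+h) + w(s)⟫`, integrated over
`s ∈ [0, t]`. Since `w(s+h) + w(s)` lies in `V` for almost all `s`, the equation can be tested with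
it. -/
lemma integral_norm_sq_sub_eq [ENNReal.HolderConjugate q p] (hp : p ≠ ∞) (hq : q ≠ ∞)
    (hfm : StronglyMeasurable f) (hWm : StronglyMeasurable W)
    (hf : MemLp f q volume) (hW : MemLp W p volume)
    (hw : ContinuousOn w (Icc 0 T)) (hver : ∀ᵐ r ∂(volume.restrict (Icc 0 T)), ι (W r) = w r)
    (heq : ∀ v, ∀ t ∈ Icc 0 T, inner ℝ (w t) (ι v) = inner ℝ (w 0) (ι v) +
      ∫ r in (0 : ℝ)..t, f r v) {t h : ℝ} (ht : 0 ≤ t) (hh : 0 ≤ h) (hth : t + h ≤ T) :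
    (∫ r in t..(t + h), ‖w r‖ ^ 2) - ∫ r in (0 : ℝ)..(0 + h), ‖w r‖ ^ 2 =
      ∫ σ in (0 : ℝ)..(0 + h), ((∫ s in Ioc 0 t, f (σ + s) (W (h + s))) +
        ∫ s in Ioc 0 t, f (σ + s) (W (0 + s))) := by
  have hq1 : 1 ≤ q := ENNReal.HolderTriple.le q p 1
  have hn : ContinuousOn (fun r => ‖w r‖ ^ 2) (Icc 0 T) := hw.norm.pow 2
  have hii : ∀ a ∈ Icc 0 T, ∀ b ∈ Icc 0 T, IntervalIntegrable (fun r => ‖w r‖ ^ 2) volume a b :=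
    fun a ha b hb => (hn.mono (uIcc_subset_Icc ha hb)).intervalIntegrable
  have m0 : (0 : ℝ) ∈ Icc 0 T := ⟨le_rfl, by linarith⟩
  have mt : t ∈ Icc 0 T := ⟨ht, by linarith⟩
  have mh : h ∈ Icc 0 T := ⟨hh, by linarith⟩
  have mth : t + h ∈ Icc 0 T := ⟨by linarith, hth⟩
  have hWh : MemLp (fun s => W (h + s)) p volume :=
    hW.comp_measurePreserving (measurePreserving_add_left volume h)
  have hfσ : ∀ σ : ℝ, MemLp (fun s => f (σ + s)) q volume := fun σ =>
    hf.comp_measurePreserving (measurePreserving_add_left volume σ)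
  have hX : MemLp (fun s => W (h + s) + W s) p volume := hWh.add hW
  have hXm : StronglyMeasurable (fun s => W (h + s) + W s) :=
    (hWm.comp_measurable (measurable_const.add measurable_id)).add hWm
  set L := ContinuousLinearMap.id ℝ (StrongDual ℝ V)
  calc (∫ r in t..(t + h), ‖w r‖ ^ 2) - ∫ r in (0 : ℝ)..(0 + h), ‖w r‖ ^ 2
      = (∫ r in h..(t + h), ‖w r‖ ^ 2) - ∫ r in (0 : ℝ)..t, ‖w r‖ ^ 2 := by
        have e1 := intervalIntegral.integral_add_adjacent_intervals (hii 0 m0 t mt)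
          (hii t mt _ mth)
        have e2 := intervalIntegral.integral_add_adjacent_intervals (hii 0 m0 h mh)
          (hii h mh _ mth)
        rw [zero_add]
        linarith
    _ = ∫ s in (0 : ℝ)..t, (‖w (h + s)‖ ^ 2 - ‖w s‖ ^ 2) := by
        have e := intervalIntegral.integral_comp_add_left (a := 0) (b := t)
          (fun r => ‖w r‖ ^ 2) h
        rw [add_zero, add_comm h t] at e
        rw [← e, intervalIntegral.integral_sub _ (hii 0 m0 t mt)]
        refine (hn.comp (continuousOn_const.add continuousOn_id) ?_).intervalIntegrable
        intro s hs
        rw [uIcc_of_le ht] at hs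
        exact ⟨add_nonneg hh hs.1, show h + s ≤ T by linarith [hs.2]⟩
    _ = ∫ s in Ioc 0 t, ∫ σ in Ioc 0 h, L (f (σ + s)) (W (h + s) + W s) := by
        rw [intervalIntegral.integral_of_le ht]
        refine setIntegral_congr_ae measurableSet_Ioc ?_
        have hv := (ae_restrict_iff' measurableSet_Icc).1 hver
        have hv' := (measurePreserving_add_left volume h).quasiMeasurePreserving.ae hv
        filter_upwards [hv, hv'] with s h1 h2 hs
        have ms : s ∈ Icc 0 T := ⟨hs.1.le, hs.2.trans mt.2⟩
        have mhs : h + s ∈ Icc 0 T := ⟨by linarith [hs.1], by linarith [hs.2]⟩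
        have e1 : ι (W (h + s) + W s) = w (h + s) + w s := by rw [map_add, h1 ms, h2 mhs]
        have e2 : ‖w (h + s)‖ ^ 2 - ‖w s‖ ^ 2 =
            inner ℝ (w (h + s)) (ι (W (h + s) + W s)) - inner ℝ (w s) (ι (W (h + s) + W s)) := by
          rw [e1, ← inner_sub_left, inner_add_right, inner_sub_left, inner_sub_left,
            real_inner_self_eq_norm_sq, real_inner_self_eq_norm_sq, real_inner_comm (w s)]
          ring
        rw [e2, heq _ _ mhs, heq _ _ ms, add_sub_add_left_eq_sub,
          intervalIntegral.integral_interval_sub_left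
            (intervalIntegrable_apply_of_memLp hq1 hf _ _ _)
            (intervalIntegrable_apply_of_memLp hq1 hf _ _ _),
          ← intervalIntegral.integral_of_le hh]
        have e3 := intervalIntegral.integral_comp_add_right (a := 0) (b := h)
          (fun r => f r (W (h + s) + W s)) s
        rw [zero_add] at e3
        exact e3.symm
    _ = ∫ σ in Ioc 0 h, ∫ s in Ioc 0 t, L (f (σ + s)) (W (h + s) + W s) :=
        integral_integral_swap (integrable_prod_bilin_translate L hp hq hfm hXm hf hX t h)
    _ = ∫ σ in Ioc 0 h, ((∫ s in Ioc 0 t, f (σ + s) (W (h + s))) +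
          ∫ s in Ioc 0 t, f (σ + s) (W (0 + s))) := by
        refine setIntegral_congr_fun measurableSet_Ioc fun σ _ => ?_
        simp only [map_add, zero_add]
        exact integral_add (integrable_bilin_of_memLp L (hfσ σ) hWh).restrict
          (integrable_bilin_of_memLp L (hfσ σ) hW).restrict
    _ = _ := by rw [zero_add, intervalIntegral.integral_of_le hh]

/-- Division of `integral_norm_sq_sub_eq` by `h` and passage to the limit `h → 0`. -/
lemma norm_sq_eq_add_integral_of_lt [ENNReal.HolderConjugate q p] (hp : p ≠ ∞) (hq : q ≠ ∞)
    (hfm : StronglyMeasurable f) (hWm : StronglyMeasurable W)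
    (hf : MemLp f q volume) (hW : MemLp W p volume)
    (hw : ContinuousOn w (Icc 0 T)) (hver : ∀ᵐ r ∂(volume.restrict (Icc 0 T)), ι (W r) = w r)
    (heq : ∀ v, ∀ t ∈ Icc 0 T, inner ℝ (w t) (ι v) = inner ℝ (w 0) (ι v) +
      ∫ r in (0 : ℝ)..t, f r v) {t : ℝ} (ht : t ∈ Ico 0 T) :
    ‖w t‖ ^ 2 = ‖w 0‖ ^ 2 + ∫ r in (0 : ℝ)..t, 2 * f r (W r) := by
  have hn : ContinuousOn (fun r => ‖w r‖ ^ 2) (Icc 0 T) := hw.norm.pow 2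
  have hΦ := continuous_setIntegral_bilin_translate (ContinuousLinearMap.id ℝ (StrongDual ℝ V))
    hp hq hf hW (Ioc 0 t)
  simp only [ContinuousLinearMap.id_apply] at hΦ
  set Φ : ℝ × ℝ → ℝ := fun z => ∫ s in Ioc 0 t, f (z.1 + s) (W (z.2 + s)) with hΦdef
  have hI : ∫ r in (0 : ℝ)..t, 2 * f r (W r) = 2 * Φ (0, 0) := by
    rw [intervalIntegral.integral_const_mul, intervalIntegral.integral_of_le ht.1, hΦdef]
    simp
  rw [hI, ← sub_eq_zero, ← abs_nonpos_iff]
  refine le_of_forall_pos_le_add fun ε hε => ?_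
  rw [zero_add]
  have hε' : 0 < ε / 4 := by positivity
  obtain ⟨δ₁, hδ₁, h1⟩ := Metric.continuous_iff.1 hΦ (0, 0) (ε / 4) hε'
  obtain ⟨δ₂, hδ₂, h2⟩ := Metric.uniformContinuousOn_iff_le.1
    (isCompact_Icc.uniformContinuousOn_of_continuous hn) (ε / 4) hε'
  have htT : 0 < T - t := sub_pos.2 ht.2
  set h := min (T - t) (min (δ₁ / 2) δ₂) with hh
  have hh0 : 0 < h := by positivity
  have hhT : h ≤ T - t := min_le_left _ _
  have hh1 : h < δ₁ := ((min_le_right _ _).trans (min_le_left _ _)).trans_lt (half_lt_self hδ₁)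
  have hh2 : h ≤ δ₂ := (min_le_right _ _).trans (min_le_right _ _)
  have key := integral_norm_sq_sub_eq hp hq hfm hWm hf hW hw hver heq ht.1 hh0.le (by linarith)
  have near : ∀ a, 0 ≤ a → a + h ≤ T →
      |(∫ r in a..(a + h), ‖w r‖ ^ 2) - h * ‖w a‖ ^ 2| ≤ ε / 4 * h := by
    intro a ha haT
    have hs : Icc a (a + h) ⊆ Icc 0 T := Icc_subset_Icc ha haT
    refine abs_integral_sub_mul_le hh0.le ?_ fun r hr => ?_
    · exact (hn.mono (by rwa [uIcc_of_le (by linarith)])).intervalIntegrable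
    · refine h2 r (hs (Ioc_subset_Icc_self hr)) a (hs ⟨le_rfl, by linarith⟩) ?_
      rw [Real.dist_eq, abs_of_pos (by linarith [hr.1])]
      linarith [hr.2]
  have n1 := near t ht.1 (by linarith)
  have n2 := near 0 le_rfl (by linarith [ht.1])
  have hΨ : Continuous fun σ : ℝ => Φ (σ, h) + Φ (σ, 0) :=
    (hΦ.comp (Continuous.prodMk_left h)).add (hΦ.comp (Continuous.prodMk_left 0))
  have n3 : |(∫ σ in (0 : ℝ)..(0 + h), (Φ (σ, h) + Φ (σ, 0))) - h * (2 * Φ (0, 0))| ≤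
      ε / 2 * h := by
    refine abs_integral_sub_mul_le hh0.le (hΨ.intervalIntegrable _ _) fun σ hσ => ?_
    rw [zero_add] at hσ
    have aσ : |σ| < δ₁ := by rw [abs_of_pos hσ.1]; linarith [hσ.2]
    have ah : |h| < δ₁ := by rwa [abs_of_pos hh0]
    have d1 := h1 (σ, h) (by simpa [Prod.dist_eq] using ⟨aσ, ah⟩)
    have d2 := h1 (σ, 0) (by simpa [Prod.dist_eq] using aσ)
    rw [Real.dist_eq, abs_lt] at d1 d2
    rw [abs_le]
    constructor <;> linarith [d1.1, d1.2, d2.1, d2.2]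
  rw [← key] at n3
  rw [abs_le] at n1 n2 n3
  have fin : |‖w t‖ ^ 2 - (‖w 0‖ ^ 2 + 2 * Φ (0, 0))| * h ≤ ε * h := by
    rw [← abs_of_pos hh0, ← abs_mul, abs_of_pos hh0, abs_le]
    constructor <;> linarith [n1.1, n1.2, n2.1, n2.2, n3.1, n3.2]
  exact le_of_mul_le_mul_right fin hh0

/-- The energy equality: if `w ∈ C([0,T]; H)` is represented by `W ∈ L^p(V)` and has derivative
`f ∈ L^q(V*)`, then `‖w(t)‖² = ‖w(0)‖² + 2 ∫₀ᵗ f(W)`. -/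
lemma norm_sq_eq_add_integral [ENNReal.HolderConjugate q p] (hp : p ≠ ∞) (hq : q ≠ ∞)
    (hf : MemLp f q (volume.restrict (Icc 0 T))) (hW : MemLp W p (volume.restrict (Icc 0 T)))
    (hw : ContinuousOn w (Icc 0 T)) (hver : ∀ᵐ r ∂(volume.restrict (Icc 0 T)), ι (W r) = w r)
    (heq : ∀ v, ∀ t ∈ Icc 0 T, inner ℝ (w t) (ι v) = inner ℝ (w 0) (ι v) +
      ∫ r in (0 : ℝ)..t, f r v) {t : ℝ} (ht : t ∈ Icc 0 T) :
    ‖w t‖ ^ 2 = ‖w 0‖ ^ 2 + ∫ r in (0 : ℝ)..t, 2 * f r (W r) := by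
  have hT : 0 ≤ T := ht.1.trans ht.2
  obtain ⟨f', hfm, hfL, haf⟩ := hf.exists_stronglyMeasurable_extension
  obtain ⟨W', hWm, hWL, haW⟩ := hW.exists_stronglyMeasurable_extension
  have hcongr : ∀ {g k : ℝ → ℝ}, (∀ᵐ r ∂(volume.restrict (Icc 0 T)), g r = k r) → ∀ s ∈ Icc 0 T,
      ∫ r in (0 : ℝ)..s, g r = ∫ r in (0 : ℝ)..s, k r := fun h s hs => by
    refine intervalIntegral.integral_congr_ae ?_
    filter_upwards [(ae_restrict_iff' measurableSet_Icc).1 h] with r hr hrs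
    rw [uIoc_of_le hs.1] at hrs
    exact hr ⟨hrs.1.le, hrs.2.trans hs.2⟩
  -- the averaging looks ahead of `t`, so it covers `t < T`; the endpoint follows by continuity
  have hlt : ∀ s ∈ Ico 0 T, ‖w s‖ ^ 2 = ‖w 0‖ ^ 2 + ∫ r in (0 : ℝ)..s, 2 * f' r (W' r) := by
    intro s hs
    refine norm_sq_eq_add_integral_of_lt (ι := ι) hp hq hfm hWm hfL hWL hw ?_ ?_ hs
    · filter_upwards [hver, haW] with r h1 h2
      rw [h2, h1]
    · intro v s hs
      rw [heq v s hs, hcongr (g := fun r => f r v) (k := fun r => f' r v)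
        (by filter_upwards [haf] with r hr; rw [hr]) s hs]
  have hint : IntervalIntegrable (fun r => 2 * f' r (W' r)) volume 0 T := by
    have := integrable_bilin_of_memLp (ContinuousLinearMap.id ℝ (StrongDual ℝ V)) hfL hWL
    exact (this.const_mul 2).intervalIntegrable
  have hle : ‖w t‖ ^ 2 = ‖w 0‖ ^ 2 + ∫ r in (0 : ℝ)..t, 2 * f' r (W' r) := by
    rcases hT.eq_or_lt with rfl | hT0
    · have : t = 0 := le_antisymm ht.2 ht.1
      simp [this]
    · have hc1 : ContinuousOn (fun s => ‖w s‖ ^ 2) (Icc 0 T) := hw.norm.pow 2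
      have hc2 : ContinuousOn (fun s => ‖w 0‖ ^ 2 + ∫ r in (0 : ℝ)..s, 2 * f' r (W' r))
          (Icc 0 T) := by
        refine continuousOn_const.add ?_
        have := intervalIntegral.continuousOn_primitive_interval' hint left_mem_uIcc
        rwa [uIcc_of_le hT] at this
      refine EqOn.of_subset_closure (s := Ico 0 T) hlt hc1 hc2 Ico_subset_Icc_self ?_ ht
      rw [closure_Ico hT0.ne]
  rw [hle, hcongr (by filter_upwards [haf, haW] with r h1 h2; rw [h1, h2]) t ht]

end Energy

/-! ### The drift along a path -/

section Drift

variable {H : Type*} [NormedAddCommGroup H] [InnerProductSpace ℝ H]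
variable {V : Type*} [NormedAddCommGroup V] [NormedSpace ℝ V]
variable {ι : V →L[ℝ] H} {A : V → StrongDual ℝ V} {α ϖ C K γ β T : ℝ} {η ρ : V → ℝ}

/-- In a Gelfand triple with reflexive `V` and separable `H`, the dual `V*` is separable, as `H` is
dense in it: a functional on `V*` vanishing on `H` is the evaluation at some `v` with
`⟪h, ι v⟫ = 0` for all `h`. -/
lemma IsGelfandTriple.separableSpace_dual [TopologicalSpace.SeparableSpace H]
    (hι : IsGelfandTriple ι) : TopologicalSpace.SeparableSpace (StrongDual ℝ V) := by
  let j : H →ₗ[ℝ] StrongDual ℝ V :=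
    { toFun := fun h => (innerSL ℝ h).comp ι
      map_add' := fun x y => by ext v; simp
      map_smul' := fun c x => by ext v; simp }
  have hc : Continuous j := (innerSL ℝ (E := H)).continuous.clm_comp continuous_const
  suffices hd : DenseRange j from hd.separableSpace hc
  intro x
  by_contra hx
  have hcl : closure (range j) = (LinearMap.range j).topologicalClosure := rfl
  rw [hcl] at hx
  obtain ⟨f, u, h1, h2⟩ := geometric_hahn_banach_closed_point
    (Submodule.convex (LinearMap.range j).topologicalClosure)
    (Submodule.isClosed_topologicalClosure _) hx
  obtain ⟨v, rfl⟩ := hι.reflexive f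
  have h3 : ∀ h : H, inner ℝ h (ι v) < u := fun h =>
    h1 (j h) (Submodule.le_topologicalClosure _ ⟨h, rfl⟩)
  have h4 : ι v = 0 := by
    by_contra hne
    have h5 := h3 ((u / ‖ι v‖ ^ 2) • ι v)
    have h6 : ‖ι v‖ ^ 2 ≠ 0 := by simpa using hne
    rw [inner_smul_left, real_inner_self_eq_norm_sq] at h5
    simp [h6] at h5
  have h5 : v = 0 := hι.injective (by rw [h4, map_zero])
  have h6 := h3 0
  rw [inner_zero_left] at h6
  rw [h5, map_zero] at h2
  exact lt_asymm h6 h2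

lemma IsPath.smul {u : ℝ → H} {U : ℝ → V} (hu : IsPath ι α T u U) {c : ℝ → ℝ}
    (hc : ContinuousOn c (Icc 0 T)) : IsPath ι α T (fun t => c t • u t) (fun t => c t • U t) where
  continuousOn := hc.smul hu.continuousOn
  version := by
    filter_upwards [hu.version] with r hr
    rw [map_smul, hr]
  memLp := by
    obtain ⟨Z, hZ⟩ := isCompact_Icc.exists_bound_of_continuousOn hc
    refine hu.memLp.of_le_mul (c := Z)
      ((hc.aestronglyMeasurable measurableSet_Icc).smul hu.memLp.1) ?_
    filter_upwards [ae_restrict_mem measurableSet_Icc] with r hr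
    rw [norm_smul]
    exact mul_le_mul_of_nonneg_right (hZ r hr) (norm_nonneg _)

variable [MeasurableSpace V]

lemma LocallyMonotoneCoercive.holderConjugate (hA : LocallyMonotoneCoercive ι A α ϖ C K γ η ρ) :
    (α / (α - 1)).HolderConjugate α :=
  (Real.HolderConjugate.conjExponent (by linarith [hA.two_le_alpha])).symm

/-- By the growth condition, `A` maps `L^α(0,T; V) ∩ L^∞(0,T; H)` to `L^{α/(α-1)}(0,T; V*)`. -/
lemma LocallyMonotoneCoercive.memLp_comp [BorelSpace V] [TopologicalSpace.SeparableSpace H]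
    (hι : IsGelfandTriple ι) (hA : LocallyMonotoneCoercive ι A α ϖ C K γ η ρ)
    {u : ℝ → H} {U : ℝ → V} (hu : IsPath ι α T u U) :
    MemLp (fun r => A (U r)) (ENNReal.ofReal (α / (α - 1))) (volume.restrict (Icc 0 T)) := by
  have hsep := hι.separableSpace_dual
  have hα := hA.two_le_alpha
  have hpos : 0 < α / (α - 1) := by
    have : 0 < α - 1 := by linarith
    positivity
  have hm : AEStronglyMeasurable (fun r => A (U r)) (volume.restrict (Icc 0 T)) :=
    (hA.measurable.comp_aemeasurable hu.memLp.1.aemeasurable).aestronglyMeasurable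
  rw [← integrable_norm_rpow_iff hm (by simpa using hpos) ENNReal.ofReal_ne_top,
    ENNReal.toReal_ofReal hpos.le]
  have hU : Integrable (fun r => ‖U r‖ ^ α) (volume.restrict (Icc 0 T)) := by
    have := (integrable_norm_rpow_iff hu.memLp.1 (by simp; linarith) ENNReal.ofReal_ne_top).2
      hu.memLp
    rwa [ENNReal.toReal_ofReal (by linarith)] at this
  obtain ⟨R, hR⟩ := isCompact_Icc.exists_bound_of_continuousOn hu.continuousOn
  have hdom : Integrable (fun r => C * (1 + ‖U r‖ ^ α) * (1 + R ^ ϖ))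
      (volume.restrict (Icc 0 T)) :=
    (((integrable_const 1).add hU).const_mul C).mul_const _
  refine hdom.mono' (hm.norm.aemeasurable.pow_const _).aestronglyMeasurable ?_
  filter_upwards [hu.version, ae_restrict_mem measurableSet_Icc] with r h1 h2
  rw [Real.norm_of_nonneg (by positivity)]
  refine (hA.growth (U r)).trans ?_
  have hC := hA.C_nonneg
  have hR' : ‖ι (U r)‖ ^ ϖ ≤ R ^ ϖ :=
    Real.rpow_le_rpow (norm_nonneg _) (h1 ▸ hR r h2) hA.varpi_nonneg
  gcongr

end Drift

/-! ### Equivalence of the two equations -/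

lemma noisePaths.exists_holderOnWith {γ₁ : ℝ≥0} {ω : ℝ → ℝ} (hω : ω ∈ noisePaths γ₁) (T : ℝ) :
    ∃ K : ℝ≥0, HolderOnWith K γ₁ ω (Icc 0 T) := by
  obtain ⟨k, hk⟩ := exists_nat_ge T
  obtain ⟨K, hK⟩ := hω.2 k
  exact ⟨K, hK.mono (Icc_subset_Icc (by simp) hk)⟩

section Equations

variable {H : Type*} [NormedAddCommGroup H] [InnerProductSpace ℝ H]
variable {V : Type*} [NormedAddCommGroup V] [NormedSpace ℝ V]
variable {ι : V →L[ℝ] H} {A : V → StrongDual ℝ V} {α ϖ C K γ β T : ℝ} {η ρ : V → ℝ}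
variable {ω : ℝ → ℝ} {γ₁ : ℝ≥0}

lemma noisePaths.continuousOn_exp (hγ₁ : 1 / 2 < γ₁) (hω : ω ∈ noisePaths γ₁) (c T : ℝ) :
    ContinuousOn (fun t => Real.exp (c * ω t)) (Icc 0 T) := by
  obtain ⟨K, hK⟩ := noisePaths.exists_holderOnWith hω T
  exact (continuousOn_const.mul (hK.continuousOn (lt_trans (by norm_num) hγ₁))).rexp

/-- If `u` solves the random equation, then `exp (β ω) u` solves the equation with the Young
integral. -/
lemma IsRandomPDESolution.isSPDESolution (hT : 0 ≤ T) (hγ₁ : 1 / 2 < γ₁)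
    (hω : ω ∈ noisePaths γ₁) {a : H} {u : ℝ → H} {U : ℝ → V}
    (h : IsRandomPDESolution ι A α β T ω a u U) :
    IsSPDESolution ι A α β T ω a (fun t => Real.exp (β * ω t) • u t)
      (fun t => Real.exp (β * ω t) • U t) := by
  obtain ⟨K, hK⟩ := noisePaths.exists_holderOnWith hω T
  have hpath := h.isPath.smul (noisePaths.continuousOn_exp hγ₁ hω β T)
  have hz : ∀ r, Real.exp (β * ω r) * Real.exp (-β * ω r) = 1 := fun r => by
    rw [← Real.exp_add]; simp
  have hint : ∀ v, IntervalIntegrable (fun r => A (Real.exp (β * ω r) • U r) v) volume 0 T := by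
    intro v
    have := (h.integrable v).continuousOn_mul (g := fun r => Real.exp (β * ω r))
      (by rw [uIcc_of_le hT]; exact noisePaths.continuousOn_exp hγ₁ hω β T)
    simpa only [← mul_assoc, hz, one_mul] using this
  have h0 : Real.exp (β * ω 0) • u 0 = a := by rw [hω.1, h.initial]; simp
  refine ⟨hpath, h0, hint, fun v t ht => ?_⟩
  refine ⟨_, hasYoungIntegral_of_exp_mul (X := fun r => inner ℝ (Real.exp (β * ω r) • u r) (ι v))
    hγ₁ hK (hpath.continuousOn.inner continuousOn_const) (hint v) ?_ ht, ?_⟩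
  · intro s hs
    have e : ∀ r, Real.exp (-β * ω r) * inner ℝ (Real.exp (β * ω r) • u r) (ι v) =
        inner ℝ (u r) (ι v) := fun r => by
      rw [real_inner_smul_left, ← mul_assoc, mul_comm (Real.exp _), hz, one_mul]
    rw [e, e, h.equation v s hs, h.initial]
  · simp only [h0]
    ring

/-- If `u` solves the equation with the Young integral, then `exp (-β ω) u` solves the random
equation. -/
lemma IsSPDESolution.isRandomPDESolution (hT : 0 ≤ T) (hγ₁ : 1 / 2 < γ₁)
    (hω : ω ∈ noisePaths γ₁) {a : H} {u : ℝ → H} {U : ℝ → V}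
    (h : IsSPDESolution ι A α β T ω a u U) :
    IsRandomPDESolution ι A α β T ω a (fun t => Real.exp (-β * ω t) • u t)
      (fun t => Real.exp (-β * ω t) • U t) := by
  obtain ⟨K, hK⟩ := noisePaths.exists_holderOnWith hω T
  have hz : ∀ r, Real.exp (β * ω r) • Real.exp (-β * ω r) • U r = U r := fun r => by
    rw [smul_smul, ← Real.exp_add]; simp
  have hzc := noisePaths.continuousOn_exp hγ₁ hω (-β) T
  refine ⟨h.isPath.smul hzc, by simp [hω.1, h.initial], fun v => ?_, fun v t ht => ?_⟩
  · simp only [hz]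
    exact (h.integrable v).continuousOn_mul (by rwa [uIcc_of_le hT])
  · simp only [hz, real_inner_smul_left]
    rw [exp_mul_eq_of_hasYoungIntegral (X := fun r => inner ℝ (u r) (ι v)) hγ₁ hK
      (h.isPath.continuousOn.inner continuousOn_const) (h.integrable v) ?_ ht]
    · simp [hω.1, h.initial]
    · intro s hs
      obtain ⟨I, hI, he⟩ := h.equation v s hs
      have : I = inner ℝ (u s) (ι v) - inner ℝ (u 0) (ι v) - ∫ r in (0 : ℝ)..s, A (U r) v := by
        rw [he, h.initial]; ring
      rwa [this] at hI

variable [MeasurableSpace V] [BorelSpace V] [TopologicalSpace.SeparableSpace H]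

/-- The drift `z A(z⁻¹ U)` of the random equation belongs to `L^{α/(α-1)}(0,T; V*)`. -/
lemma IsPath.memLp_drift (hγ₁ : 1 / 2 < γ₁) (hω : ω ∈ noisePaths γ₁)
    (hι : IsGelfandTriple ι) (hA : LocallyMonotoneCoercive ι A α ϖ C K γ η ρ)
    {u : ℝ → H} {U : ℝ → V} (hu : IsPath ι α T u U) (β : ℝ) :
    MemLp (fun r => Real.exp (-β * ω r) • A (Real.exp (β * ω r) • U r))
      (ENNReal.ofReal (α / (α - 1))) (volume.restrict (Icc 0 T)) := by
  have hc := noisePaths.continuousOn_exp hγ₁ hω (-β) T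
  have hm := hA.memLp_comp hι (hu.smul (noisePaths.continuousOn_exp hγ₁ hω β T))
  obtain ⟨Z, hZ⟩ := isCompact_Icc.exists_bound_of_continuousOn hc
  refine hm.of_le_mul (c := Z) ((hc.aestronglyMeasurable measurableSet_Icc).smul hm.1) ?_
  filter_upwards [ae_restrict_mem measurableSet_Icc] with r hr
  rw [norm_smul]
  exact mul_le_mul_of_nonneg_right (hZ r hr) (norm_nonneg _)

/-! ### Continuous dependence on the initial value -/

/-- The energy equality for the difference of two solutions, local monotonicity at the points
`z⁻¹ u₂` and `z⁻¹ u₁`, and Grönwall's inequality. -/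
lemma IsRandomPDESolution.norm_sub_sq_le (hγ₁ : 1 / 2 < γ₁) (hω : ω ∈ noisePaths γ₁)
    (hι : IsGelfandTriple ι) (hA : LocallyMonotoneCoercive ι A α ϖ C K γ η ρ)
    {a₁ a₂ : H} {u₁ u₂ : ℝ → H} {U₁ U₂ : ℝ → V}
    (h₁ : IsRandomPDESolution ι A α β T ω a₁ u₁ U₁)
    (h₂ : IsRandomPDESolution ι A α β T ω a₂ u₂ U₂)
    (hint : IntervalIntegrable
      (fun s => ρ (Real.exp (β * ω s) • U₁ s) + η (Real.exp (β * ω s) • U₂ s)) volume 0 T)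
    {t : ℝ} (ht : t ∈ Icc 0 T) :
    ‖u₁ t - u₂ t‖ ^ 2 ≤ Real.exp (∫ s in (0 : ℝ)..t,
      (C + ρ (Real.exp (β * ω s) • U₁ s) + η (Real.exp (β * ω s) • U₂ s))) * ‖a₁ - a₂‖ ^ 2 := by
  have hT : 0 ≤ T := ht.1.trans ht.2
  have hpq := hA.holderConjugate
  have : ENNReal.HolderConjugate (ENNReal.ofReal (α / (α - 1))) (ENNReal.ofReal α) :=
    hpq.ennrealOfReal
  have hf := (h₁.isPath.memLp_drift hγ₁ hω hι hA β).sub (h₂.isPath.memLp_drift hγ₁ hω hι hA β)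
  set f : ℝ → StrongDual ℝ V := (fun r => Real.exp (-β * ω r) • A (Real.exp (β * ω r) • U₁ r)) -
    fun r => Real.exp (-β * ω r) • A (Real.exp (β * ω r) • U₂ r) with hfdef
  have hW := h₁.isPath.memLp.sub h₂.isPath.memLp
  have hw : ContinuousOn (fun t => u₁ t - u₂ t) (Icc 0 T) :=
    h₁.isPath.continuousOn.sub h₂.isPath.continuousOn
  have hver : ∀ᵐ r ∂(volume.restrict (Icc 0 T)), ι ((U₁ - U₂) r) = u₁ r - u₂ r := by
    filter_upwards [h₁.isPath.version, h₂.isPath.version] with r e1 e2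
    rw [Pi.sub_apply, map_sub, e1, e2]
  have heq : ∀ v, ∀ t ∈ Icc 0 T, inner ℝ (u₁ t - u₂ t) (ι v) =
      inner ℝ (u₁ 0 - u₂ 0) (ι v) + ∫ r in (0 : ℝ)..t, f r v := by
    intro v s hs
    have hsub : uIcc 0 s ⊆ uIcc 0 T := by
      rw [uIcc_of_le hs.1, uIcc_of_le hT]; exact Icc_subset_Icc le_rfl hs.2
    have e : ∫ r in (0 : ℝ)..s, f r v =
        (∫ r in (0 : ℝ)..s, Real.exp (-β * ω r) * A (Real.exp (β * ω r) • U₁ r) v) -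
          ∫ r in (0 : ℝ)..s, Real.exp (-β * ω r) * A (Real.exp (β * ω r) • U₂ r) v :=
      intervalIntegral.integral_sub ((h₁.integrable v).mono_set hsub)
        ((h₂.integrable v).mono_set hsub)
    rw [e, inner_sub_left, inner_sub_left, h₁.equation v s hs, h₂.equation v s hs,
      h₁.initial, h₂.initial]
    ring
  have hE : ∀ s ∈ Icc 0 T, ‖u₁ s - u₂ s‖ ^ 2 = ‖u₁ 0 - u₂ 0‖ ^ 2 +
      ∫ r in (0 : ℝ)..s, 2 * f r ((U₁ - U₂) r) := fun s hs =>
    norm_sq_eq_add_integral (ι := ι) ENNReal.ofReal_ne_top ENNReal.ofReal_ne_top hf hW hw hver heq hs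
  have hsub : uIcc 0 t ⊆ uIcc 0 T := by
    rw [uIcc_of_le ht.1, uIcc_of_le hT]; exact Icc_subset_Icc le_rfl ht.2
  have hIcc : Icc 0 t ⊆ Icc 0 T := Icc_subset_Icc le_rfl ht.2
  have he : IntervalIntegrable (fun r => 2 * f r ((U₁ - U₂) r)) volume 0 T := by
    have := integrable_bilin_of_memLp (ContinuousLinearMap.id ℝ (StrongDual ℝ V)) hf hW
    rw [intervalIntegrable_iff_integrableOn_Icc_of_le hT]
    exact this.const_mul 2
  have hg : IntervalIntegrable (fun s => C + ρ (Real.exp (β * ω s) • U₁ s) +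
      η (Real.exp (β * ω s) • U₂ s)) volume 0 T := by
    simpa only [add_assoc] using (intervalIntegrable_const (c := C)).add hint
  have key := gronwall_of_integrable (E := fun s => ‖u₁ s - u₂ s‖ ^ 2) ht.1
    (he.mono_set hsub) (hg.mono_set hsub) (fun s hs => hE s (hIcc hs)) ?_
  · rwa [h₁.initial, h₂.initial] at key
  · refine ae_restrict_of_ae_restrict_of_subset hIcc ?_
    filter_upwards [hver] with r hr
    rw [← hr, ← neg_sub U₂ U₁, Pi.neg_apply, Pi.sub_apply, map_neg (f r), map_neg ι, norm_neg]
    have hmon := hA.locallyMonotone (Real.exp (β * ω r) • U₂ r) (Real.exp (β * ω r) • U₁ r)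
    have hz : Real.exp (β * ω r) * Real.exp (-β * ω r) = 1 := by
      rw [← Real.exp_add]; simp
    rw [← smul_sub, map_smul, map_smul, norm_smul, Real.norm_of_nonneg (Real.exp_pos _).le,
      smul_eq_mul, sub_apply] at hmon
    have hfr : f r (U₂ r - U₁ r) =
        Real.exp (-β * ω r) * A (Real.exp (β * ω r) • U₁ r) (U₂ r - U₁ r) -
          Real.exp (-β * ω r) * A (Real.exp (β * ω r) • U₂ r) (U₂ r - U₁ r) := rfl
    rw [hfr]
    generalize A (Real.exp (β * ω r) • U₂ r) (U₂ r - U₁ r) = m₂ at *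
    generalize A (Real.exp (β * ω r) • U₁ r) (U₂ r - U₁ r) = m₁ at *
    generalize ‖ι (U₂ r - U₁ r)‖ = d at *
    generalize η (Real.exp (β * ω r) • U₂ r) = e₂ at *
    generalize ρ (Real.exp (β * ω r) • U₁ r) = e₁ at *
    generalize Real.exp (-β * ω r) = z at *
    have hz' := mul_le_mul_of_nonneg_left hmon (sq_nonneg z)
    -- multiplying the local monotonicity inequality by `z²` removes the factors `z⁻¹` from both sides
    calc 2 * -(z * m₁ - z * m₂) = (Real.exp (β * ω r) * z) * (2 * (z * (m₂ - m₁))) := by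
          rw [hz]; ring
      _ = z ^ 2 * (2 * (Real.exp (β * ω r) * (m₂ - m₁))) := by ring
      _ ≤ _ := hz'
      _ = (Real.exp (β * ω r) * z) ^ 2 * ((C + e₂ + e₁) * d ^ 2) := by ring
      _ = (C + e₁ + e₂) * d ^ 2 := by rw [hz]; ring

/-! ### Hölder regularity in time -/

lemma holderOnWith_of_abs_sub_le {f : ℝ → ℝ} {S : Set ℝ} {L : ℝ} {r : ℝ≥0}
    (h : ∀ x ∈ S, ∀ y ∈ S, |f x - f y| ≤ L * |x - y| ^ (r : ℝ)) :
    HolderOnWith L.toNNReal r f S := by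
  intro x hx y hy
  rw [edist_dist, edist_dist, Real.dist_eq, Real.dist_eq,
    ENNReal.ofReal_rpow_of_nonneg (abs_nonneg _) r.coe_nonneg]
  refine (ENNReal.ofReal_le_ofReal (h x hx y hy)).trans ?_
  rw [ENNReal.ofReal_mul' (by positivity)]
  rfl

/-- By Hölder's inequality, the primitive of a function in `L^{p}` is Hölder continuous with
exponent `1/q`, where `p` and `q` are conjugate. -/
lemma abs_integral_le_rpow {b : ℝ → ℝ} {p q T s t : ℝ} (hpq : p.HolderConjugate q)
    (hb : MemLp b (ENNReal.ofReal p) (volume.restrict (Icc 0 T)))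
    (hs : 0 ≤ s) (hst : s ≤ t) (ht : t ≤ T) :
    |∫ r in s..t, b r| ≤ (∫ r in Icc 0 T, |b r| ^ p) ^ (1 / p) * (t - s) ^ (1 / q) := by
  have hsub : Ioc s t ⊆ Icc 0 T := fun r hr => ⟨hs.trans hr.1.le, hr.2.trans ht⟩
  have hb' : MemLp b (ENNReal.ofReal p) (volume.restrict (Ioc s t)) :=
    hb.mono_measure (Measure.restrict_mono hsub le_rfl)
  have h1 := integral_mul_norm_le_Lp_mul_Lq hpq hb' (memLp_const (1 : ℝ))
  have hi : Integrable (fun r => |b r| ^ p) (volume.restrict (Icc 0 T)) := by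
    have := (integrable_norm_rpow_iff hb.1 (by simpa using hpq.pos) ENNReal.ofReal_ne_top).2 hb
    simpa only [ENNReal.toReal_ofReal hpq.nonneg, Real.norm_eq_abs] using this
  calc |∫ r in s..t, b r| ≤ ∫ r in Ioc s t, ‖b r‖ := by
        rw [intervalIntegral.integral_of_le hst, ← Real.norm_eq_abs]
        exact norm_integral_le_integral_norm _
    _ ≤ (∫ r in Ioc s t, |b r| ^ p) ^ (1 / p) * (t - s) ^ (1 / q) := by
        simpa [hst] using h1
    _ ≤ _ := by
        have hnn : ∀ r, 0 ≤ |b r| ^ p := fun r => by positivity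
        have : ∫ r in Ioc s t, |b r| ^ p ≤ ∫ r in Icc 0 T, |b r| ^ p :=
          setIntegral_mono_set hi (ae_of_all _ hnn) hsub.eventuallyLE
        have h0 : 0 ≤ ∫ r in Ioc s t, |b r| ^ p := integral_nonneg hnn
        have hts : 0 ≤ t - s := sub_nonneg.2 hst
        have hp := hpq.nonneg
        gcongr

/-- The function `⟪z⁻¹ u, v⟫` is the product of the `γ₁`-Hölder continuous `exp (β ω)` and the
`1/α`-Hölder continuous `⟪u, v⟫`. -/
lemma IsRandomPDESolution.exists_holderOnWith (hT : 0 ≤ T) (hγ₁ : 1 / 2 < γ₁)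
    (hω : ω ∈ noisePaths γ₁)
    (hι : IsGelfandTriple ι) (hA : LocallyMonotoneCoercive ι A α ϖ C K γ η ρ)
    {a : H} {u : ℝ → H} {U : ℝ → V} (h : IsRandomPDESolution ι A α β T ω a u U)
    {γ₂ : ℝ≥0} (h1 : γ₂ ≤ γ₁) (h2 : (γ₂ : ℝ) ≤ 1 / α) (v : V) :
    ∃ L : ℝ≥0, HolderOnWith L γ₂ (fun t => inner ℝ (Real.exp (β * ω t) • u t) (ι v))
      (Icc 0 T) := by
  have hα := hA.two_le_alpha
  obtain ⟨K', hK'⟩ := noisePaths.exists_holderOnWith hω T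
  have hdiam : ∀ x ∈ Icc 0 T, ∀ y ∈ Icc 0 T, edist x y ≤ (T.toNNReal : ℝ≥0∞) := by
    intro x hx y hy
    rw [edist_dist]
    exact ENNReal.ofReal_le_ofReal (by
      rw [Real.dist_eq, abs_le]
      constructor <;> linarith [hx.1, hx.2, hy.1, hy.2])
  set y : ℝ → ℝ := fun t => inner ℝ (u t) (ι v) with hy
  have hb : MemLp (fun r => Real.exp (-β * ω r) * A (Real.exp (β * ω r) • U r) v)
      (ENNReal.ofReal (α / (α - 1))) (volume.restrict (Icc 0 T)) := by
    exact (ContinuousLinearMap.apply ℝ ℝ v).comp_memLp' (h.isPath.memLp_drift hγ₁ hω hι hA β)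
  -- `⟪u, v⟫` has derivative in `L^{α/(α-1)}`, so it is `1/α`-Hölder continuous
  obtain ⟨L, hL⟩ : ∃ L : ℝ, ∀ s ∈ Icc 0 T, ∀ t ∈ Icc 0 T,
      |y s - y t| ≤ L * |s - t| ^ (1 / α) := by
    refine ⟨(∫ r in Icc 0 T, |Real.exp (-β * ω r) * A (Real.exp (β * ω r) • U r) v| ^
      (α / (α - 1))) ^ (1 / (α / (α - 1))), ?_⟩
    have hi : ∀ s ∈ Icc 0 T, IntervalIntegrable
        (fun r => Real.exp (-β * ω r) * A (Real.exp (β * ω r) • U r) v) volume 0 s := fun s hs =>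
      (h.integrable v).mono_set (by
        rw [uIcc_of_le hs.1, uIcc_of_le hT]; exact Icc_subset_Icc le_rfl hs.2)
    intro s hs t ht
    wlog hst : t ≤ s generalizing s t
    · rw [abs_sub_comm, abs_sub_comm s]
      exact this t ht s hs (le_of_not_ge hst)
    have e : y s - y t = ∫ r in t..s, Real.exp (-β * ω r) * A (Real.exp (β * ω r) • U r) v := by
      rw [← intervalIntegral.integral_interval_sub_left (hi s hs) (hi t ht), hy]
      simp only
      rw [h.equation v s hs, h.equation v t ht]
      ring
    rw [e, abs_of_nonneg (sub_nonneg.2 hst)]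
    exact abs_integral_le_rpow hA.holderConjugate hb ht.1 hst hs.2
  have hα' : (0 : ℝ) ≤ 1 / α := by positivity
  have hy1 : HolderOnWith L.toNNReal (Real.toNNReal (1 / α)) y (Icc 0 T) :=
    holderOnWith_of_abs_sub_le (by simpa only [Real.coe_toNNReal _ hα'] using hL)
  have hy2 := hy1.of_le (s := γ₂) hdiam (NNReal.le_toNNReal_of_coe_le h2)
  have hω2 := hK'.of_le (s := γ₂) hdiam h1
  generalize L.toNNReal * T.toNNReal ^ ((Real.toNNReal (1 / α) : ℝ) - γ₂) = L₁ at hy2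
  generalize K' * T.toNNReal ^ ((γ₁ : ℝ) - γ₂) = L₂ at hω2
  have hyc : ContinuousOn y (Icc 0 T) := h.isPath.continuousOn.inner continuousOn_const
  have hωc : ContinuousOn ω (Icc 0 T) := hK'.continuousOn (lt_trans (by norm_num) hγ₁)
  obtain ⟨B, hB⟩ := isCompact_Icc.exists_bound_of_continuousOn hyc
  obtain ⟨R, hR⟩ := isCompact_Icc.exists_bound_of_continuousOn hωc
  obtain ⟨Z, hZ⟩ := isCompact_Icc.exists_bound_of_continuousOn
    (noisePaths.continuousOn_exp hγ₁ hω β T)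
  have hsm : ContDiff ℝ 1 fun x => Real.exp (β * x) := (contDiff_const.mul contDiff_id).exp
  obtain ⟨D, hD⟩ := (hsm.contDiffOn (s := Icc (-R) R)).exists_lipschitzOnWith (by decide)
    (convex_Icc _ _) isCompact_Icc
  refine ⟨_, holderOnWith_of_abs_sub_le (L := D * L₂ * B + Z * L₁) fun s hs t ht => ?_⟩
  have d1 : |Real.exp (β * ω s) - Real.exp (β * ω t)| ≤ D * (L₂ * |s - t| ^ (γ₂ : ℝ)) := by
    have e1 := hD.dist_le_mul _ (abs_le.1 (hR s hs)) _ (abs_le.1 (hR t ht))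
    have e2 := hω2.dist_le hs ht
    exact e1.trans (mul_le_mul_of_nonneg_left e2 D.2)
  have d2 : |y s - y t| ≤ L₁ * |s - t| ^ (γ₂ : ℝ) := hy2.dist_le hs ht
  have d3 : |y t| ≤ B := hB t ht
  have d4 : |Real.exp (β * ω s)| ≤ Z := hZ s hs
  simp only [real_inner_smul_left]
  change |Real.exp (β * ω s) * y s - Real.exp (β * ω t) * y t| ≤ _
  calc |Real.exp (β * ω s) * y s - Real.exp (β * ω t) * y t|
      = |(Real.exp (β * ω s) - Real.exp (β * ω t)) * y t + Real.exp (β * ω s) * (y s - y t)| := by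
        congr 1; ring
    _ ≤ |Real.exp (β * ω s) - Real.exp (β * ω t)| * |y t| + |Real.exp (β * ω s)| * |y s - y t| := by
        rw [← abs_mul, ← abs_mul]
        exact abs_add_le _ _
    _ ≤ D * (L₂ * |s - t| ^ (γ₂ : ℝ)) * B + Z * (L₁ * |s - t| ^ (γ₂ : ℝ)) := by
        have hZ0 := (abs_nonneg _).trans d4
        gcongr
    _ = _ := by ring

end Equations

/-! ### The estimates for both equations -/

theorem mainTheorem8 (β T : ℝ) (hT : 0 < T) (γ₁ : ℝ≥0) (hγ₁ : 1 / 2 < γ₁)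
    (ω : ℝ → ℝ) (hω : ω ∈ noisePaths γ₁) :
    ∃ M : ℝ, 0 < M ∧
    ∀ (H : Type*) [NormedAddCommGroup H] [InnerProductSpace ℝ H] [CompleteSpace H]
      [TopologicalSpace.SeparableSpace H]
      (V : Type*) [NormedAddCommGroup V] [NormedSpace ℝ V] [CompleteSpace V]
      [MeasurableSpace V] [BorelSpace V]
      (ι : V →L[ℝ] H) (_ : IsGelfandTriple ι) (_ : IsCompactOperator ι)
      (A : V → StrongDual ℝ V) (α ϖ C K γ : ℝ) (η ρ : V → ℝ)
      (_ : LocallyMonotoneCoercive ι A α ϖ C K γ η ρ),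
    -- solutions of the random equation, and their transforms, which solve the SPDE
    (∀ (a₁ a₂ : H) (u₁ u₂ : ℝ → H) (U₁ U₂ : ℝ → V),
      IsRandomPDESolution ι A α β T ω a₁ u₁ U₁ →
      IsRandomPDESolution ι A α β T ω a₂ u₂ U₂ →
      IntervalIntegrable (fun s => ρ (Real.exp (β * ω s) • U₁ s) + η (Real.exp (β * ω s) • U₂ s))
        volume 0 T →
      (∀ t ∈ Icc 0 T, ‖u₁ t - u₂ t‖ ^ 2 ≤
        Real.exp (∫ s in (0 : ℝ)..t,
          (C + ρ (Real.exp (β * ω s) • U₁ s) + η (Real.exp (β * ω s) • U₂ s))) *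
          ‖a₁ - a₂‖ ^ 2) ∧
      IsSPDESolution ι A α β T ω a₁ (fun t => Real.exp (β * ω t) • u₁ t)
        (fun t => Real.exp (β * ω t) • U₁ t) ∧
      IsSPDESolution ι A α β T ω a₂ (fun t => Real.exp (β * ω t) • u₂ t)
        (fun t => Real.exp (β * ω t) • U₂ t) ∧
      (∀ γ₂ : ℝ≥0, γ₂ ≤ γ₁ → (γ₂ : ℝ) ≤ 1 / α → ∀ v : V, ∃ L₁ L₂ : ℝ≥0,
        HolderOnWith L₁ γ₂ (fun t => inner ℝ (Real.exp (β * ω t) • u₁ t) (ι v)) (Icc 0 T) ∧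
        HolderOnWith L₂ γ₂ (fun t => inner ℝ (Real.exp (β * ω t) • u₂ t) (ι v)) (Icc 0 T)) ∧
      (∀ t ∈ Icc 0 T, ‖Real.exp (β * ω t) • u₁ t - Real.exp (β * ω t) • u₂ t‖ ^ 2 ≤
        M * Real.exp (∫ s in (0 : ℝ)..t,
          (C + ρ (Real.exp (β * ω s) • U₁ s) + η (Real.exp (β * ω s) • U₂ s))) *
          ‖a₁ - a₂‖ ^ 2)) ∧
    -- arbitrary solutions of the SPDE
    (∀ (a₁ a₂ : H) (u₁ u₂ : ℝ → H) (U₁ U₂ : ℝ → V),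
      IsSPDESolution ι A α β T ω a₁ u₁ U₁ →
      IsSPDESolution ι A α β T ω a₂ u₂ U₂ →
      IntervalIntegrable (fun s => ρ (U₁ s) + η (U₂ s)) volume 0 T →
      ∀ t ∈ Icc 0 T, ‖u₁ t - u₂ t‖ ^ 2 ≤
        M * Real.exp (∫ s in (0 : ℝ)..t, (C + ρ (U₁ s) + η (U₂ s))) * ‖a₁ - a₂‖ ^ 2) := by
  obtain ⟨Z, hZ⟩ := isCompact_Icc.exists_bound_of_continuousOn
    (noisePaths.continuousOn_exp hγ₁ hω β T)
  have hZ0 : 0 < Z :=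
    (norm_pos_iff.2 (Real.exp_ne_zero _)).trans_le (hZ 0 ⟨le_rfl, hT.le⟩)
  -- `Z` bounds `z⁻¹ = exp (β ω)`, which multiplies the squared norm by at most `Z²`
  refine ⟨Z ^ 2, by positivity, ?_⟩
  intro H _ _ _ _ V _ _ _ _ _ ι hι _ A α ϖ C K γ η ρ hA
  have hscale : ∀ t ∈ Icc 0 T, ∀ x : H, ‖Real.exp (β * ω t) • x‖ ^ 2 ≤ Z ^ 2 * ‖x‖ ^ 2 := by
    intro t ht x
    rw [norm_smul, mul_pow]
    have := hZ t ht
    gcongr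
  constructor
  · intro a₁ a₂ u₁ u₂ U₁ U₂ h₁ h₂ hint
    have hle := fun t ht => h₁.norm_sub_sq_le hγ₁ hω hι hA h₂ hint (t := t) ht
    refine ⟨hle, h₁.isSPDESolution hT.le hγ₁ hω, h₂.isSPDESolution hT.le hγ₁ hω,
      fun γ₂ h1 h2 v => ?_, fun t ht => ?_⟩
    · obtain ⟨L₁, hL₁⟩ := h₁.exists_holderOnWith hT.le hγ₁ hω hι hA h1 h2 v
      obtain ⟨L₂, hL₂⟩ := h₂.exists_holderOnWith hT.le hγ₁ hω hι hA h1 h2 v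
      exact ⟨L₁, L₂, hL₁, hL₂⟩
    · rw [← smul_sub, mul_assoc]
      exact (hscale t ht _).trans (mul_le_mul_of_nonneg_left (hle t ht) (by positivity))
  · intro a₁ a₂ u₁ u₂ U₁ U₂ h₁ h₂ hint t ht
    have hzV : ∀ r (x : V), Real.exp (β * ω r) • Real.exp (-β * ω r) • x = x := fun r x => by
      rw [smul_smul, ← Real.exp_add]; simp
    have hzH : ∀ r (x : H), Real.exp (β * ω r) • Real.exp (-β * ω r) • x = x := fun r x => by
      rw [smul_smul, ← Real.exp_add]; simp
    have hle := (h₁.isRandomPDESolution hT.le hγ₁ hω).norm_sub_sq_le hγ₁ hω hι hA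
      (h₂.isRandomPDESolution hT.le hγ₁ hω) (by simpa only [hzV] using hint) ht
    simp only [hzV] at hle
    rw [← hzH t (u₁ t - u₂ t), smul_sub (Real.exp (-β * ω t)), mul_assoc]
    exact (hscale t ht _).trans (mul_le_mul_of_nonneg_left hle (by positivity))
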